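/- Let $q\ge 1$, let $\Theta\subset\mathbb R^q$ be open, bounded and convex with closure $\Theta^c$, let $\theta\in\Theta$, and let $a:[0,\infty)\times\Theta^c\to\mathbb R$ be continuous with $a(t,\cdot)\in C^1(\Theta)$ for every $t\ge 0$. Observe $X(t)=a(t,\theta)+\varepsilon(t)$, $t\ge 0$, where the noise $\varepsilon=\{\varepsilon(t),\,t\in\mathbb R\}$ is a stochastic process on a probability space $(\Omega,\mathfrak F,P)$. A least squares estimator $\theta_T$ is a random vector with values in $\Theta^c$ that (almost surely) minimizes $Q_T(\tau)=\int_0^T [X(t)-a(t,\tau)]^2\,dt$ over $\tau\in\Theta^c$. A process $\zeta=\{\zeta(t),\,t\in\mathbb R\}$ is called jointly strictly sub-Gaussian if $E\exp\{\sum_i\Delta_i\zeta(t_i)\}\le\exp\{\frac12\sum_{i,j}\Delta_i\Delta_j E\zeta(t_i)\zeta(t_j)\}$ for all $n\ge 1$, $t_1,\dots,t_n\in\mathbb R$ and $\Delta\in\mathbb R^n$. Assume the following. (N1) $\varepsilon$ is mean-square continuous and almost surely continuous, and $E\varepsilon(t)=0$ for all $t$. (N4(i)) $\varepsilon(t)=\int_{-\infty}^t\psi(t-s)\,d\xi(s)$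 for all $t\in\mathbb R$ (mean-square Stieltjes integral), where $\xi=\{\xi(t),\,t\in\mathbb R\}$ is a mean-square continuous, jointly strictly sub-Gaussian process with orthogonal increments, $E\xi(t)=0$ and $E|\xi(t+s)-\xi(t)|^2=s$ for $t\in\mathbb R$, $s>0$; $\psi(t)=0$ for $t<0$ and $\int_0^\infty\psi^2(t)\,dt<\infty$. (N4(ii)) $f_0=\sup_{\lambda\in\mathbb R}|h(i\lambda)|^2<\infty$, where $h(i\lambda)=(2\pi)^{-1/2}\int_0^\infty\psi(t)e^{-i\lambda t}\,dt$ (the $L_2$ Fourier transform, so that the supremum is the essential supremum). (R3) There are $T_0\ge 0$, diagonal matrices $s_T=\mathrm{diag}(s_{1T},\dots,s_{qT})$ not depending on the parameter, and constants $0<\underline c_i<\overline c_i<\infty$ such that, with $d_{iT}(\tau)=\bigl(\int_0^T(\partial a(t,\tau)/\partial\tau_i)^2dt\bigr)^{1/2}$, one has $\underline c_i<s_{iT}^{-1}d_{iT}(\tau)<\overline c_i$ for all $i$, $\tau\in\Theta$, $T>T_0$; and there are numbers $0<c_0<c_1<\infty$ such that $$c_0\|u-v\|^2\le\int_0^T\bigl[a(t,\theta+s_T^{-1}u)-a(t,\theta+s_T^{-1}v)\bigr]^2dt\le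 c_1\|u-v\|^2$$ for all $T>T_0$ and $u,v\in U_T(\theta)=s_T(\Theta^c-\theta)$. Then there is $R_0>0$ such that for every $\beta>0$ there are constants $B,b>0$ with $$b\ge\frac{c_0}{16\pi f_0(1+q)}-\beta$$ (in the degenerate case $f_0=0$ this is only the requirement $b>0$) such that for all $T>T_0$, every least squares estimator $\theta_T$, and all $R>R_0$, $$P\{\|s_T(\theta_T-\theta)\|\ge R\}\le B\exp\{-bR^2\}.$$ -/

import Mathlib

open MeasureTheory Filter Topology
open scoped FourierTransform ENNReal

noncomputable section

/-! ### Strictly sub-Gaussian vectors and processes -/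

/-- A random vector `(ξ₁, …, ξₙ)` is strictly sub-Gaussian: for every `Δ ∈ ℝⁿ`,
`E exp ⟨ξ, Δ⟩` is finite and at most `exp (½ ⟨BΔ, Δ⟩)` with `B i j = E ξᵢ ξⱼ`. -/
def IsStrictlySubGaussian {Ω : Type*} [MeasurableSpace Ω] (P : Measure Ω) {n : ℕ}
    (ξ : Fin n → Ω → ℝ) : Prop :=
  (∀ i, MemLp (ξ i) 2 P) ∧
    ∀ Δ : Fin n → ℝ,
      Integrable (fun ω => Real.exp (∑ i, ξ i ω * Δ i)) P ∧
        ∫ ω, Real.exp (∑ i, ξ i ω * Δ i) ∂P ≤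
          Real.exp (1 / 2 * ∑ i, ∑ j, (∫ ω, ξ i ω * ξ j ω ∂P) * Δ i * Δ j)

/-- A jointly strictly sub-Gaussian process: all its finite-dimensional vectors are strictly
sub-Gaussian. -/
def IsJointlyStrictlySubGaussian {Ω : Type*} [MeasurableSpace Ω] (P : Measure Ω)
    (ξ : ℝ → Ω → ℝ) : Prop :=
  ∀ (n : ℕ) (t : Fin n → ℝ), IsStrictlySubGaussian P (fun i => ξ (t i))

/-- Mean-square continuity of a second-order process indexed by `ℝ`. -/
def IsMeanSquareContinuous {Ω : Type*} [MeasurableSpace Ω] (P : Measure Ω)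
    (ξ : ℝ → Ω → ℝ) : Prop :=
  (∀ t, MemLp (ξ t) 2 P) ∧
    ∀ t, Tendsto (fun s => eLpNorm (fun ω => ξ s ω - ξ t ω) 2 P) (𝓝 t) (𝓝 0)

/-! ### The noise -/

/-- Basic assumption on the noise: a centred stochastic process which is mean-square continuous
and has almost surely continuous paths. -/
structure IsCentredContinuousNoise {Ω : Type*} [MeasurableSpace Ω] (P : Measure Ω)
    (ε : ℝ → Ω → ℝ) : Prop where
  measurable : ∀ t, Measurable (ε t)
  meanSquareContinuous : IsMeanSquareContinuous P ε
  ae_continuous : ∀ᵐ ω ∂P, Continuous (fun t => ε t ω)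
  mean_zero : ∀ t, ∫ ω, ε t ω ∂P = 0

/-- An integrated white noise on `ℝ`: a centred, mean-square continuous, jointly strictly
sub-Gaussian process with orthogonal increments and `E |ξ(t+s) - ξ(t)|² = s`. -/
structure IsSubGaussianIntegratedWhiteNoise {Ω : Type*} [MeasurableSpace Ω] (P : Measure Ω)
    (ξ : ℝ → Ω → ℝ) : Prop where
  measurable : ∀ t, Measurable (ξ t)
  meanSquareContinuous : IsMeanSquareContinuous P ξ
  jointlyStrictlySubGaussian : IsJointlyStrictlySubGaussian P ξ
  orthogonal_increments : ∀ t₁ t₂ t₃ t₄ : ℝ, t₁ < t₂ → t₂ ≤ t₃ → t₃ < t₄ →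
    ∫ ω, (ξ t₂ ω - ξ t₁ ω) * (ξ t₄ ω - ξ t₃ ω) ∂P = 0
  mean_zero : ∀ t, ∫ ω, ξ t ω ∂P = 0
  increment_variance : ∀ t s : ℝ, 0 < s → ∫ ω, |ξ (t + s) ω - ξ t ω| ^ 2 ∂P = s

/-- A simple function `∑ₗ cₗ 1_{[αₗ, βₗ)}` on the line. -/
structure SimpleStep where
  r : ℕ
  c : Fin r → ℝ
  α : Fin r → ℝ
  β : Fin r → ℝ
  α_le_β : ∀ l, α l ≤ β l

/-- The simple function as a function on `ℝ`. -/
def SimpleStep.eval (g : SimpleStep) (s : ℝ) : ℝ :=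
  ∑ l, (Set.Ico (g.α l) (g.β l)).indicator (fun _ => g.c l) s

/-- The stochastic integral of a simple function, `∑ₗ cₗ (ξ(βₗ) - ξ(αₗ))`. -/
def SimpleStep.integral {Ω : Type*} (g : SimpleStep) (ξ : ℝ → Ω → ℝ) (ω : Ω) : ℝ :=
  ∑ l, g.c l * (ξ (g.β l) ω - ξ (g.α l) ω)

/-- `Y` is (a version of) the mean-square Stieltjes integral `∫ φ(s) dξ(s)`: the `L²(Ω)`-limit of
the integrals of simple functions which approximate `φ` in `L²(ℝ)`. -/
def IsMeanSquareStieltjesIntegral {Ω : Type*} [MeasurableSpace Ω] (P : Measure Ω)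
    (ξ : ℝ → Ω → ℝ) (φ : ℝ → ℝ) (Y : Ω → ℝ) : Prop :=
  ∃ g : ℕ → SimpleStep,
    Tendsto (fun m => eLpNorm (fun s => φ s - (g m).eval s) 2 volume) atTop (𝓝 0) ∧
      Tendsto (fun m => eLpNorm (fun ω => Y ω - (g m).integral ξ ω) 2 P) atTop (𝓝 0)

/-- `ε(t) = ∫_{-∞}^t ψ(t - s) dξ(s)` for all `t`, where `ψ` vanishes on the negative
half-line, is square integrable, and `ξ` is an integrated white noise as above. -/
structure IsFilteredWhiteNoise {Ω : Type*} [MeasurableSpace Ω] (P : Measure Ω)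
    (ψ : ℝ → ℝ) (ξ ε : ℝ → Ω → ℝ) : Prop where
  noise : IsSubGaussianIntegratedWhiteNoise P ξ
  causal : ∀ t < 0, ψ t = 0
  sq_integrable : MemLp ψ 2 volume
  eq_integral : ∀ t, IsMeanSquareStieltjesIntegral P ξ (fun s => ψ (t - s)) (ε t)

/-- The transfer function `h(iλ) = (2π)^{-1/2} ∫₀^∞ ψ(t) e^{-iλt} dt` of a square integrable
filter `ψ` supported on the positive half-line. As `ψ` need not be integrable, the integral is the
`L²` Fourier transform; Mathlib's one has the kernel `e^{-2πiλt}`, hence the rescaling. -/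
def transferFunction (ψ : ℝ → ℝ) (hψ : MemLp ψ 2 volume) (lam : ℝ) : ℂ :=
  (((2 * Real.pi) ^ (-(1 / 2) : ℝ) : ℝ) : ℂ) *
    (𝓕 (MemLp.toLp (fun t => (ψ t : ℂ)) hψ.ofReal) : Lp ℂ 2 (volume : Measure ℝ))
      (lam / (2 * Real.pi))

/-- `f₀ = sup_λ |h(iλ)|²` in `[0, ∞]`; the supremum is essential since `h` is defined up to null
sets. -/
def spectralSup (ψ : ℝ → ℝ) (hψ : MemLp ψ 2 volume) : ℝ≥0∞ :=
  essSup (fun lam : ℝ => ENNReal.ofReal (‖transferFunction ψ hψ lam‖ ^ 2)) volume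

/-! ### The regression model and its normalization -/

/-- The product `diag(s₁, …, s_q) x`. -/
def diagMul {q : ℕ} (s : Fin q → ℝ) (x : EuclideanSpace ℝ (Fin q)) :
    EuclideanSpace ℝ (Fin q) :=
  WithLp.toLp 2 (fun i => s i * x i)

/-- The parameter set `Θ` is open, bounded and convex, the regression function `a` is continuous
on `[0, ∞) × closure Θ`, and `a(t, ·)` is continuously differentiable on `Θ` for all `t ≥ 0`. -/
structure IsRegressionFunction {q : ℕ} (Θ : Set (EuclideanSpace ℝ (Fin q)))
    (a : ℝ → EuclideanSpace ℝ (Fin q) → ℝ) : Prop where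
  isOpen : IsOpen Θ
  isBounded : Bornology.IsBounded Θ
  convex : Convex ℝ Θ
  continuousOn : ContinuousOn (fun p : ℝ × EuclideanSpace ℝ (Fin q) => a p.1 p.2)
    (Set.Ici 0 ×ˢ closure Θ)
  contDiffOn : ∀ t, 0 ≤ t → ContDiffOn ℝ 1 (a t) Θ

/-- `d_{iT}(τ) = (∫₀ᵀ (∂a(t, τ)/∂τᵢ)² dt)^{1/2}`. -/
def dNorm {q : ℕ} (a : ℝ → EuclideanSpace ℝ (Fin q) → ℝ) (T : ℝ)
    (τ : EuclideanSpace ℝ (Fin q)) (i : Fin q) : ℝ :=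
  Real.sqrt (∫ t in (0 : ℝ)..T, (fderiv ℝ (a t) τ (EuclideanSpace.single i 1)) ^ 2)

/-- The diagonal normalization `s_T` (independent of the parameter) is equivalent to `d_T(τ)`,
uniformly in `τ ∈ Θ`, for `T > T₀`. -/
def IsNormalization {q : ℕ} (Θ : Set (EuclideanSpace ℝ (Fin q)))
    (a : ℝ → EuclideanSpace ℝ (Fin q) → ℝ) (s : ℝ → Fin q → ℝ) (T₀ : ℝ) : Prop :=
  ∃ cl cu : Fin q → ℝ, ∀ i, 0 < cl i ∧ cl i < cu i ∧
    ∀ τ ∈ Θ, ∀ T > T₀, cl i < (s T i)⁻¹ * dNorm a T τ i ∧ (s T i)⁻¹ * dNorm a T τ i < cu i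

/-- The local parameter set `U_T(θ) = s_T (closure Θ - θ)`. -/
def localSet {q : ℕ} (Θ : Set (EuclideanSpace ℝ (Fin q))) (sT : Fin q → ℝ)
    (θ : EuclideanSpace ℝ (Fin q)) : Set (EuclideanSpace ℝ (Fin q)) :=
  (fun τ => diagMul sT (τ - θ)) '' closure Θ

/-- `Δ(t, u) = a(t, θ + s_T⁻¹ u) - a(t, θ)`. -/
def regressionIncrement {q : ℕ} (a : ℝ → EuclideanSpace ℝ (Fin q) → ℝ) (sT : Fin q → ℝ)
    (θ : EuclideanSpace ℝ (Fin q)) (t : ℝ) (u : EuclideanSpace ℝ (Fin q)) : ℝ :=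
  a t (θ + diagMul (fun i => (sT i)⁻¹) u) - a t θ

/-- `Φ_T(u, v) = ∫₀ᵀ (Δ(t, u) - Δ(t, v))² dt`. -/
def phiDist {q : ℕ} (a : ℝ → EuclideanSpace ℝ (Fin q) → ℝ) (sT : Fin q → ℝ)
    (θ : EuclideanSpace ℝ (Fin q)) (T : ℝ) (u v : EuclideanSpace ℝ (Fin q)) : ℝ :=
  ∫ t in (0 : ℝ)..T, (regressionIncrement a sT θ t u - regressionIncrement a sT θ t v) ^ 2

/-- Two-sided quadratic bound: `c₀ ‖u - v‖² ≤ Φ_T(u, v) ≤ c₁ ‖u - v‖²` for all `u, v ∈ U_T(θ)` and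
all `T > T₀`. -/
def QuadraticSeparation {q : ℕ} (Θ : Set (EuclideanSpace ℝ (Fin q)))
    (a : ℝ → EuclideanSpace ℝ (Fin q) → ℝ) (s : ℝ → Fin q → ℝ)
    (θ : EuclideanSpace ℝ (Fin q)) (T₀ c₀ c₁ : ℝ) : Prop :=
  ∀ T > T₀, ∀ u ∈ localSet Θ (s T) θ, ∀ v ∈ localSet Θ (s T) θ,
    c₀ * ‖u - v‖ ^ 2 ≤ phiDist a (s T) θ T u v ∧ phiDist a (s T) θ T u v ≤ c₁ * ‖u - v‖ ^ 2

/-! ### The least squares estimator -/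

/-- `Q_T(τ) = ∫₀ᵀ (X(t) - a(t, τ))² dt`, along the path `ω`. -/
def leastSquaresCriterion {Ω : Type*} {q : ℕ} (a : ℝ → EuclideanSpace ℝ (Fin q) → ℝ)
    (X : ℝ → Ω → ℝ) (T : ℝ) (ω : Ω) (τ : EuclideanSpace ℝ (Fin q)) : ℝ :=
  ∫ t in (0 : ℝ)..T, (X t ω - a t τ) ^ 2

/-- `θT` is a least squares estimator from the observations on `[0, T]`: a random vector with
values in `closure Θ` which minimizes `Q_T` over `closure Θ` (almost surely, since `Q_T` itself is
only defined for almost all paths). -/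
def IsLeastSquaresEstimator {Ω : Type*} [MeasurableSpace Ω] (P : Measure Ω) {q : ℕ}
    (Θ : Set (EuclideanSpace ℝ (Fin q))) (a : ℝ → EuclideanSpace ℝ (Fin q) → ℝ)
    (X : ℝ → Ω → ℝ) (T : ℝ) (θT : Ω → EuclideanSpace ℝ (Fin q)) : Prop :=
  Measurable θT ∧ ∀ᵐ ω ∂P, θT ω ∈ closure Θ ∧
    IsMinOn (leastSquaresCriterion a X T ω) (closure Θ) (θT ω)

end

/-! In local coordinates `u = s_T (τ - θ)` put η(u) = ∫₀ᵀ Δ(t,u) ε(t) dt. Comparing the least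
squares criterion at the estimator and at `θ` gives Φ(u,0) ≤ 2 η(u) at the estimated `u`. So it is
enough to bound the probability that this inequality holds somewhere on `‖u‖ ≥ R`.

Increments of η are sub-Gaussian with proxy 2π f₀ Φ(u,v)
(`IsFilteredWhiteNoise.hasSubgaussianMGF_integral`). Strict sub-Gaussianity of ξ makes the proxy of
a step integral equal to its variance, which is the squared `L²` norm of the step function. Limits
carry this to Riemann sums of ∫ f ε, where Plancherel turns the variance into an integral of |ĥ|²
against a trigonometric sum, and the supremum of the spectral density comes out.

At a single point, P(2η(u) ≥ Φ(u,0)) ≤ exp(-Φ(u,0) / (8 s2)) with `s2 ≥ 2π f₀`, and Φ(u,0) ≥ c₀‖u‖².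
The rate kept is `b ≤ c₀ / (16 s2)`, half of what is available. The other half pays for the supremum
by chaining (`exists_tail_bound`): the nets cover the whole local set at once, and a spare factor
exp(-(b/4)‖x‖²) makes the union bound converge independently of the size of that set
(`exists_sum_exp_le_of_separated`). Hence `B` does not depend on `T`. For `q ≥ 1` and `f₀ > 0`, the
rate c₀ / (32π f₀) is at least the required c₀ / (16π f₀ (1+q)). -/

/-! ### The `L²` Fourier transform: agreement with the integral, translations, Plancherel. -/

section Fourier

open scoped SchwartzMap ContDiff

/-- The multiplication formula for the `L²` Fourier transform. -/
theorem integral_smul_Lp_fourier_eq (f : Lp ℂ 2 (volume : Measure ℝ)) (φ : 𝓢(ℝ, ℂ)) :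
    ∫ x, φ x • (𝓕 f : Lp ℂ 2 (volume : Measure ℝ)) x = ∫ x, (𝓕 φ) x • f x := by
  have h := congrArg (fun D => D φ) (Lp.fourier_toTemperedDistribution_eq f)
  simp only [TemperedDistribution.fourier_apply, Lp.toTemperedDistribution_apply] at h
  exact h.symm

theorem Lp.locallyIntegrable_two (f : Lp ℂ 2 (volume : Measure ℝ)) :
    LocallyIntegrable f volume :=
  (Lp.memLp f).locallyIntegrable (by norm_num)

/-- A smooth compactly supported real function as a complex Schwartz function. -/
theorem exists_schwartz_eq {g : ℝ → ℂ} (hg : ContDiff ℝ ∞ g) (hs : HasCompactSupport g) :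
    ∃ φ : 𝓢(ℝ, ℂ), ∀ x, φ x = g x :=
  ⟨hs.toSchwartzMap hg, fun _ => rfl⟩

/-- An `L²` Fourier transform is identified by testing: smooth compactly supported functions
determine a locally integrable function, and the multiplication formula moves the transform onto the
test function. -/
theorem Lp_fourier_eq_of_forall {F : Lp ℂ 2 (volume : Measure ℝ)} {G : ℝ → ℂ}
    (hG : LocallyIntegrable G volume)
    (h : ∀ (g : ℝ → ℝ), ContDiff ℝ ∞ g → HasCompactSupport g → ∀ φ : 𝓢(ℝ, ℂ),
      (∀ x, φ x = g x) → ∫ x, (𝓕 φ) x * F x = ∫ x, (g x : ℂ) * G x) :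
    ((𝓕 F : Lp ℂ 2 (volume : Measure ℝ)) : ℝ → ℂ) =ᵐ[volume] G := by
  refine ae_eq_of_integral_contDiff_smul_eq (Lp.locallyIntegrable_two _) hG fun g hg hs => ?_
  obtain ⟨φ, hφ⟩ := exists_schwartz_eq (g := fun x => (g x : ℂ))
    (Complex.ofRealCLM.contDiff.comp hg) (hs.comp_left (g := Complex.ofReal) (by simp))
  have h1 := integral_smul_Lp_fourier_eq F φ
  have h2 := h g hg hs φ hφ
  simp only [smul_eq_mul, hφ] at h1
  simp only [Complex.real_smul]
  rw [h1, h2]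

/-- On `L¹ ∩ L²` the `L²` Fourier transform is given by the integral. -/
theorem Lp_fourier_toLp_eq {f : ℝ → ℂ} (h1 : Integrable f) (h2 : MemLp f 2 volume) :
    ((𝓕 (h2.toLp f) : Lp ℂ 2 (volume : Measure ℝ)) : ℝ → ℂ) =ᵐ[volume] 𝓕 f := by
  have hc : Continuous (𝓕 f : ℝ → ℂ) := by
    exact VectorFourier.fourierIntegral_continuous Real.continuous_fourierChar
      continuous_inner h1
  refine Lp_fourier_eq_of_forall hc.locallyIntegrable fun g hg hs φ hφ => ?_
  have e1 : ∫ x, (𝓕 φ) x * (h2.toLp f) x = ∫ x, (𝓕 (φ : ℝ → ℂ)) x * f x := by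
    refine integral_congr_ae ?_
    filter_upwards [h2.coeFn_toLp] with x hx
    rw [hx, SchwartzMap.fourier_coe]
  have e2 := VectorFourier.integral_fourierIntegral_smul_eq_flip (L := innerₗ ℝ)
    (μ := volume) (ν := volume) Real.continuous_fourierChar continuous_inner
    (φ.integrable (μ := volume)) h1
  rw [e1]
  simp only [← hφ]
  rw [flip_innerₗ] at e2
  exact e2

theorem Lp_fourier_comp_add {f : ℝ → ℂ} (hf : MemLp f 2 volume) (t : ℝ)
    (hft : MemLp (fun x => f (x + t)) 2 volume) :
    ((𝓕 (hft.toLp _) : Lp ℂ 2 (volume : Measure ℝ)) : ℝ → ℂ) =ᵐ[volume]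
      fun x => Complex.exp ((2 * Real.pi * t * x : ℝ) * Complex.I) *
        (𝓕 (hf.toLp f) : Lp ℂ 2 (volume : Measure ℝ)) x := by
  have hce : Continuous fun x : ℝ => Complex.exp ((2 * Real.pi * t * x : ℝ) * Complex.I) := by
    fun_prop
  refine Lp_fourier_eq_of_forall ?_ fun g hg hs φ hφ => ?_
  · have := (Lp.locallyIntegrable_two (𝓕 (hf.toLp f))).locallyIntegrableOn Set.univ
    rw [← locallyIntegrableOn_univ]
    exact this.continuousOn_mul hce.continuousOn isOpen_univ.isLocallyClosed
  -- The modulation is absorbed into the test function; the Fourier transform of `χ` is that of `φ`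
  -- translated by `t`.
  obtain ⟨χ, hχ⟩ := exists_schwartz_eq
    (g := fun x => Complex.exp ((2 * Real.pi * t * x : ℝ) * Complex.I) * (g x : ℂ))
    (by
      refine ContDiff.mul (ContDiff.cexp ?_) (Complex.ofRealCLM.contDiff.comp hg)
      exact (Complex.ofRealCLM.contDiff.comp
        (contDiff_const.mul contDiff_id)).mul contDiff_const)
    ((hs.comp_left (g := Complex.ofReal) (by simp)).mul_left)
  have h1 := integral_smul_Lp_fourier_eq (hf.toLp f) χ
  have h3 : ∀ x, (𝓕 χ) x = (𝓕 φ) (x - t) := by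
    intro x
    rw [SchwartzMap.fourier_coe, SchwartzMap.fourier_coe, Real.fourier_real_eq_integral_exp_smul,
      Real.fourier_real_eq_integral_exp_smul]
    refine integral_congr_ae (Eventually.of_forall fun v => ?_)
    simp only [hχ, hφ, smul_eq_mul]
    rw [← mul_assoc, ← Complex.exp_add]
    congr 2
    push_cast
    ring
  have e1 : ∫ x, (𝓕 φ) x * (hft.toLp _) x = ∫ x, (𝓕 φ) x * f (x + t) := by
    refine integral_congr_ae ?_
    filter_upwards [hft.coeFn_toLp] with x hx
    rw [hx]
  have e2 : ∫ x, (𝓕 χ) x • (hf.toLp f) x = ∫ x, (𝓕 φ) (x - t) * f x := by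
    refine integral_congr_ae ?_
    filter_upwards [hf.coeFn_toLp] with x hx
    rw [hx, h3, smul_eq_mul]
  rw [e1, ← integral_sub_right_eq_self _ t]
  simp only [sub_add_cancel]
  rw [← e2, ← h1]
  simp only [hχ, smul_eq_mul]
  refine integral_congr_ae (Eventually.of_forall fun v => ?_)
  ring

theorem integral_norm_sq_Lp_fourier (f : Lp ℂ 2 (volume : Measure ℝ)) :
    ∫ x, ‖(𝓕 f : Lp ℂ 2 (volume : Measure ℝ)) x‖ ^ 2 = ∫ x, ‖f x‖ ^ 2 := by
  have h (g : Lp ℂ 2 (volume : Measure ℝ)) : ∫ x, ‖g x‖ ^ 2 = ‖g‖ ^ 2 := by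
    have := L2.inner_def (𝕜 := ℂ) g g
    rw [inner_self_eq_norm_sq_to_K] at this
    simp only [inner_self_eq_norm_sq_to_K] at this
    have h' : ((‖g‖ ^ 2 : ℝ) : ℂ) = ((∫ x, ‖g x‖ ^ 2 : ℝ) : ℂ) := by
      rw [← integral_complex_ofReal]
      push_cast
      exact this
    exact (Complex.ofReal_injective h').symm
  rw [h, h, Lp.norm_fourier_eq]

theorem integral_norm_sq_congr_ae {f g : ℝ → ℂ} (h : f =ᵐ[volume] g) :
    ∫ x, ‖f x‖ ^ 2 = ∫ x, ‖g x‖ ^ 2 :=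
  integral_congr_ae (h.fun_comp fun z => ‖z‖ ^ 2)

theorem Lp_coeFn_sum_smul {ι : Type*} (s : Finset ι) (w : ι → ℂ)
    (g : ι → Lp ℂ 2 (volume : Measure ℝ)) (h : ι → ℝ → ℂ) (hgh : ∀ k, g k =ᵐ[volume] h k) :
    ((∑ k ∈ s, w k • g k : Lp ℂ 2 (volume : Measure ℝ)) : ℝ → ℂ) =ᵐ[volume]
      fun x => ∑ k ∈ s, w k * h k x := by
  classical
  induction s using Finset.induction_on with
  | empty => simpa using! Lp.coeFn_zero ℂ 2 volume
  | insert a s ha ih =>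
    rw [Finset.sum_insert ha]
    filter_upwards [Lp.coeFn_add (w a • g a) (∑ k ∈ s, w k • g k), ih, hgh a,
      Lp.coeFn_smul (w a) (g a)] with x h1 h2 h3 h4
    rw [h1, Pi.add_apply, h2, h4, Finset.sum_insert ha, Pi.smul_apply, h3, smul_eq_mul]

theorem integral_norm_sq_fourier {f : ℝ → ℂ} (h1 : Integrable f) (h2 : MemLp f 2 volume) :
    ∫ x, ‖𝓕 f x‖ ^ 2 = ∫ x, ‖f x‖ ^ 2 := by
  rw [← integral_norm_sq_congr_ae (Lp_fourier_toLp_eq h1 h2), integral_norm_sq_Lp_fourier,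
    integral_norm_sq_congr_ae h2.coeFn_toLp]

/-- The `L²` norm of a finite combination of translates, on the Fourier side. -/
theorem integral_norm_sq_sum_translates {f : ℝ → ℂ} (hf : MemLp f 2 volume) {ι : Type*}
    (s : Finset ι) (w : ι → ℂ) (t : ι → ℝ) :
    ∫ x, ‖∑ k ∈ s, w k * f (x + t k)‖ ^ 2 =
      ∫ x, ‖∑ k ∈ s, w k * Complex.exp ((2 * Real.pi * t k * x : ℝ) * Complex.I)‖ ^ 2 *
        ‖(𝓕 (hf.toLp f) : Lp ℂ 2 (volume : Measure ℝ)) x‖ ^ 2 := by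
  have ht (k : ι) : MemLp (fun x => f (x + t k)) 2 volume :=
    hf.comp_measurePreserving (measurePreserving_add_right volume (t k))
  set G : Lp ℂ 2 (volume : Measure ℝ) := ∑ k ∈ s, w k • (ht k).toLp _ with hG
  have hFG : (𝓕 G : Lp ℂ 2 (volume : Measure ℝ)) = ∑ k ∈ s, w k • 𝓕 ((ht k).toLp _) := by
    change Lp.fourierTransformₗᵢ ℝ ℂ G = ∑ k ∈ s, w k • Lp.fourierTransformₗᵢ ℝ ℂ ((ht k).toLp _)
    rw [hG, map_sum]
    simp
  have e1 := Lp_coeFn_sum_smul s w _ _ fun k => (ht k).coeFn_toLp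
  have e2 := Lp_coeFn_sum_smul s w _ _ fun k => Lp_fourier_comp_add hf (t k) (ht k)
  rw [← hG] at e1
  rw [← hFG] at e2
  rw [← integral_norm_sq_congr_ae e1, ← integral_norm_sq_Lp_fourier,
    integral_norm_sq_congr_ae e2]
  refine integral_congr_ae (Eventually.of_forall fun x => ?_)
  simp only
  rw [← mul_pow, ← norm_mul, Finset.sum_mul]
  simp only [mul_assoc]

end Fourier

/-! ### Riemann sums and the spectral bound on the variance. -/

/-- Vector-valued because it serves twice: for real integrals along noise paths and for complex
exponential sums on the Fourier side. -/
theorem tendsto_riemann_sum {E : Type*} [NormedAddCommGroup E] [NormedSpace ℝ E]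
    [CompleteSpace E] {g : ℝ → E} {T : ℝ} (hT : 0 < T) (hg : ContinuousOn g (Set.Icc 0 T)) :
    Tendsto (fun n : ℕ => ∑ k ∈ Finset.range n, (T / n) • g (k * (T / n))) atTop
      (𝓝 (∫ t in (0 : ℝ)..T, g t)) := by
  rw [Metric.tendsto_atTop]
  intro ε hε
  have huc := isCompact_Icc.uniformContinuousOn_of_continuous hg
  rw [Metric.uniformContinuousOn_iff] at huc
  obtain ⟨δ, hδ, H⟩ := huc (ε / (2 * T)) (by positivity)
  obtain ⟨N, hN⟩ := exists_nat_gt (T / δ)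
  refine ⟨N + 1, fun n hn => ?_⟩
  have hn0 : (0 : ℝ) < n := by exact_mod_cast (by omega : 0 < n)
  set h := T / n with hh
  have hh0 : 0 < h := by positivity
  have hnh : (n : ℝ) * h = T := by rw [hh]; field_simp
  have hhδ : h < δ := by
    have : (N : ℝ) < n := by exact_mod_cast (by omega : N < n)
    rw [hh, div_lt_comm₀ hn0 hδ]
    linarith
  have hsub : ∀ k < n, Set.Icc ((k : ℝ) * h) ((k + 1 : ℕ) * h) ⊆ Set.Icc 0 T := by
    intro k hk x hx
    have hk' : ((k + 1 : ℕ) : ℝ) ≤ n := by exact_mod_cast hk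
    refine ⟨le_trans (by positivity) hx.1, hx.2.trans ?_⟩
    rw [← hnh]
    gcongr
  have hle : ∀ k : ℕ, (k : ℝ) * h ≤ (k + 1 : ℕ) * h := fun k => by
    gcongr; exact Nat.le_succ k
  have hint : ∀ k < n, IntervalIntegrable g volume ((k : ℝ) * h) ((k + 1 : ℕ) * h) := fun k hk => by
    refine ContinuousOn.intervalIntegrable ?_
    rw [Set.uIcc_of_le (hle k)]
    exact hg.mono (hsub k hk)
  have hadj := intervalIntegral.sum_integral_adjacent_intervals
    (a := fun k : ℕ => (k : ℝ) * h) hint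
  simp only [Nat.cast_zero, zero_mul, hnh] at hadj
  have hone : ∀ k < n, ‖h • g (k * h) - ∫ t in ((k : ℝ) * h)..((k + 1 : ℕ) * h), g t‖
      ≤ ε / (2 * T) * h := by
    intro k hk
    have hlen : ((k + 1 : ℕ) : ℝ) * h - k * h = h := by push_cast; ring
    have hc : ∫ t in ((k : ℝ) * h)..((k + 1 : ℕ) * h), g (k * h) = h • g (k * h) := by
      rw [intervalIntegral.integral_const, hlen]
    rw [← hc, ← intervalIntegral.integral_sub intervalIntegrable_const (hint k hk)]
    have := intervalIntegral.norm_integral_le_of_norm_le_const (a := (k : ℝ) * h)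
      (b := (k + 1 : ℕ) * h) (C := ε / (2 * T)) (f := fun t => g (k * h) - g t) fun x hx => by
        rw [Set.uIoc_of_le (hle k)] at hx
        rw [← dist_eq_norm]
        refine (H _ (hsub k hk ⟨le_rfl, hle k⟩) x (hsub k hk ⟨hx.1.le, hx.2⟩) ?_).le
        rw [Real.dist_eq, abs_sub_comm, abs_of_pos (by linarith [hx.1])]
        linarith [hx.2]
    rwa [hlen, abs_of_pos hh0] at this
  rw [dist_eq_norm, ← hadj, ← Finset.sum_sub_distrib]
  calc _ ≤ ∑ k ∈ Finset.range n, ε / (2 * T) * h :=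
        norm_sum_le_of_le _ fun k hk => hone k (Finset.mem_range.1 hk)
    _ = ε / 2 := by
        rw [Finset.sum_const, Finset.card_range, nsmul_eq_mul, ← mul_assoc, mul_comm (n : ℝ),
          mul_assoc, hnh]
        field_simp
    _ < ε := by linarith

/-- The substitution λ = 2πx preserves null sets, so the essential bound on `transferFunction`
transfers; the factor 2π undoes its normalization (2π)^(-1/2). -/
theorem ae_norm_sq_fourier_le_spectralSup {ψ : ℝ → ℝ} (hψ : MemLp ψ 2 volume)
    (h : spectralSup ψ hψ < ⊤) :
    ∀ᵐ x : ℝ, ‖(𝓕 (MemLp.toLp (fun t => (ψ t : ℂ)) hψ.ofReal) :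
      Lp ℂ 2 (volume : Measure ℝ)) x‖ ^ 2 ≤ 2 * Real.pi * (spectralSup ψ hψ).toReal := by
  have hpi := Real.pi_pos
  have h1 : ∀ᵐ l : ℝ, ENNReal.ofReal (‖transferFunction ψ hψ l‖ ^ 2) ≤ spectralSup ψ hψ :=
    ENNReal.ae_le_essSup _
  have hq : Measure.QuasiMeasurePreserving (fun x : ℝ => 2 * Real.pi * x) volume volume := by
    refine ⟨by fun_prop, ?_⟩
    rw [Real.map_volume_mul_left (by positivity)]
    exact Measure.smul_absolutelyContinuous
  filter_upwards [hq.ae h1] with x hx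
  rw [ENNReal.ofReal_le_iff_le_toReal h.ne] at hx
  unfold transferFunction at hx
  rw [mul_div_cancel_left₀ _ (by positivity), norm_mul, mul_pow, Complex.norm_real,
    Real.norm_of_nonneg (by positivity), ← Real.rpow_natCast, ← Real.rpow_mul (by positivity)] at hx
  have hp : (0 : ℝ) < 2 * Real.pi := by positivity
  have he : (-(1 / 2) : ℝ) * ((2 : ℕ) : ℝ) = -1 := by norm_num
  rwa [he, Real.rpow_neg_one, inv_mul_le_iff₀ hp] at hx

/-- The variance of the Riemann sums of `∫₀ᵀ f(t) ε(t) dt`, for `ε` the noise filtered by `ψ`,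
converges to a number at most `C ∫₀ᵀ f²`, where `C` bounds the squared Fourier transform of `ψ`. -/
theorem exists_tendsto_integral_sq_riemann_sum_filter {ψ : ℝ → ℝ} (hψ : MemLp ψ 2 volume) {C : ℝ}
    (hC : ∀ᵐ x : ℝ, ‖(𝓕 (MemLp.toLp (fun t => (ψ t : ℂ)) hψ.ofReal) :
      Lp ℂ 2 (volume : Measure ℝ)) x‖ ^ 2 ≤ C)
    {f : ℝ → ℝ} {T : ℝ} (hT : 0 < T) (hf : ContinuousOn f (Set.Icc 0 T)) :
    ∃ v ≤ C * ∫ t in (0 : ℝ)..T, f t ^ 2,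
      Tendsto (fun n : ℕ => ∫ s, (∑ k ∈ Finset.range n,
        T / n * f (k * (T / n)) * ψ (k * (T / n) - s)) ^ 2) atTop (𝓝 v) := by
  set F : Lp ℂ 2 (volume : Measure ℝ) := 𝓕 (MemLp.toLp (fun t => (ψ t : ℂ)) hψ.ofReal) with hF
  have hF2 : Integrable (fun x => ‖F x‖ ^ 2) volume :=
    (memLp_two_iff_integrable_sq_norm (Lp.aestronglyMeasurable _)).1 (Lp.memLp _)
  have hfc : ContinuousOn (fun t => (f t : ℂ)) (Set.Icc 0 T) :=
    Complex.continuous_ofReal.comp_continuousOn hf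
  let e : ℝ → ℝ → ℂ := fun x t => Complex.exp ((2 * Real.pi * t * x : ℝ) * Complex.I)
  have he : ∀ x t, ‖e x t‖ = 1 := fun x t => Complex.norm_exp_ofReal_mul_I _
  let D : ℕ → ℝ → ℂ := fun n x => ∑ k ∈ Finset.range n,
    ((T / n * f (k * (T / n)) : ℝ) : ℂ) * e x (k * (T / n))
  let I : ℝ → ℂ := fun x => ∫ t in (0 : ℝ)..T, (f t : ℂ) * e x t
  have hDI : ∀ x, Tendsto (fun n => D n x) atTop (𝓝 (I x)) := by
    intro x
    have := tendsto_riemann_sum (g := fun t => (f t : ℂ) * e x t) hT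
      (hfc.mul (by fun_prop))
    refine this.congr fun n => Finset.sum_congr rfl fun k _ => ?_
    rw [Complex.real_smul]
    push_cast
    ring
  obtain ⟨M, hM⟩ := (isCompact_Icc.image_of_continuousOn hf).isBounded.exists_norm_le
  have hM' : ∀ t ∈ Set.Icc 0 T, ‖f t‖ ≤ M := fun t ht => hM _ ⟨t, ht, rfl⟩
  have hM0 : 0 ≤ M := (norm_nonneg _).trans (hM' 0 ⟨le_rfl, hT.le⟩)
  have hDM : ∀ n x, ‖D n x‖ ≤ T * M := by
    intro n x
    rcases Nat.eq_zero_or_pos n with rfl | hn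
    · simp [D]; positivity
    have hn0 : (0 : ℝ) < n := by exact_mod_cast hn
    calc ‖D n x‖ ≤ ∑ k ∈ Finset.range n, T / n * M := by
          refine norm_sum_le_of_le _ fun k hk => ?_
          have hk' : (k : ℝ) ≤ n := by exact_mod_cast (Finset.mem_range.1 hk).le
          rw [norm_mul, he, mul_one, Complex.norm_real, norm_mul, Real.norm_of_nonneg (by positivity)]
          gcongr
          refine hM' _ ⟨by positivity, ?_⟩
          calc (k : ℝ) * (T / n) ≤ n * (T / n) := by gcongr
            _ = T := by field_simp
      _ = T * M := by
          rw [Finset.sum_const, Finset.card_range, nsmul_eq_mul]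
          field_simp
  have hDc : ∀ n, Continuous (D n) := fun n => by
    refine continuous_finsetSum _ fun k _ => ?_
    fun_prop
  -- Dominated convergence: the sums `D n` are bounded by `T * M` uniformly in `n` and `x`, and
  -- `‖F‖²` is integrable.
  have hlim : Tendsto (fun n => ∫ x, ‖D n x‖ ^ 2 * ‖F x‖ ^ 2) atTop
      (𝓝 (∫ x, ‖I x‖ ^ 2 * ‖F x‖ ^ 2)) := by
    refine tendsto_integral_of_dominated_convergence (fun x => (T * M) ^ 2 * ‖F x‖ ^ 2)
      (fun n => ?_) (hF2.const_mul _) (fun n => Eventually.of_forall fun x => ?_)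
      (Eventually.of_forall fun x => ?_)
    · exact ((hDc n).norm.pow 2).aestronglyMeasurable.mul hF2.aestronglyMeasurable
    · rw [Real.norm_of_nonneg (by positivity)]
      gcongr
      exact hDM n x
    · exact (((hDI x).norm).pow 2).mul_const _
  let g : ℝ → ℂ := (Set.Ioc 0 T).indicator fun t => (f t : ℂ)
  have hg2 : MemLp g 2 volume := by
    rw [memLp_indicator_iff_restrict measurableSet_Ioc]
    exact MemLp.of_bound ((hfc.mono Set.Ioc_subset_Icc_self).aestronglyMeasurable
      measurableSet_Ioc) M <| (ae_restrict_iff' measurableSet_Ioc).2 <|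
      Eventually.of_forall fun t ht => by
        rw [Complex.norm_real]; exact hM' t (Set.Ioc_subset_Icc_self ht)
  have hg1 : Integrable g :=
    (integrable_indicator_iff measurableSet_Ioc).2
      (hfc.integrableOn_Icc.mono_set Set.Ioc_subset_Icc_self)
  have hI : ∀ x, I x = 𝓕 g (-x) := by
    intro x
    rw [Real.fourier_real_eq_integral_exp_smul]
    simp only [I]
    rw [intervalIntegral.integral_of_le hT.le, ← integral_indicator measurableSet_Ioc]
    refine integral_congr_ae (Eventually.of_forall fun t => ?_)
    by_cases ht : t ∈ Set.Ioc 0 T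
    · simp only [g, Set.indicator_of_mem ht, smul_eq_mul, e]
      rw [mul_comm]
      congr 3
      push_cast
      ring
    · simp [g, Set.indicator_of_notMem ht]
  have hIint : ∫ x, ‖I x‖ ^ 2 = ∫ t in (0 : ℝ)..T, f t ^ 2 := by
    simp only [hI]
    rw [integral_neg_eq_self (fun x => ‖𝓕 g x‖ ^ 2), integral_norm_sq_fourier hg1 hg2,
      intervalIntegral.integral_of_le hT.le, ← integral_indicator measurableSet_Ioc]
    refine integral_congr_ae (Eventually.of_forall fun t => ?_)
    by_cases ht : t ∈ Set.Ioc 0 T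
    · simp [g, Set.indicator_of_mem ht]
    · simp [g, Set.indicator_of_notMem ht]
  have hI2 : Integrable fun x => ‖I x‖ ^ 2 := by
    have h := (memLp_two_iff_integrable_sq_norm (Lp.aestronglyMeasurable _)).1
      (Lp.memLp (𝓕 (hg2.toLp g)))
    simp only [hI]
    exact (h.congr ((Lp_fourier_toLp_eq hg1 hg2).fun_comp fun z => ‖z‖ ^ 2)).comp_neg
  refine ⟨∫ x, ‖I x‖ ^ 2 * ‖F x‖ ^ 2, ?_, ?_⟩
  -- `‖F‖² ≤ C` comes out of the integral, and Plancherel for `f` on (0, T] evaluates the rest.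
  · rw [← hIint, ← integral_const_mul]
    refine integral_mono_of_nonneg (Eventually.of_forall fun x => by positivity)
      (hI2.const_mul _) ?_
    filter_upwards [hC] with x hx
    rw [mul_comm]
    gcongr
  · refine hlim.congr fun n => ?_
    have := integral_norm_sq_sum_translates (f := fun t => (ψ t : ℂ)) hψ.ofReal (Finset.range n)
      (fun k => ((T / n * f (k * (T / n)) : ℝ) : ℂ)) (fun k => k * (T / n))
    -- The reflection of `s` turns the kernels `ψ (t - s)` into translates `ψ (s + t)`.
    rw [← integral_neg_eq_self fun s => (∑ k ∈ Finset.range n,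
      T / n * f (k * (T / n)) * ψ (k * (T / n) - s)) ^ 2]
    refine this.symm.trans (integral_congr_ae (Eventually.of_forall fun s => ?_))
    simp only [← Complex.ofReal_mul, ← Complex.ofReal_sum, Complex.norm_real, Real.norm_eq_abs,
      sq_abs, sub_neg_eq_add]
    simp only [add_comm]

/-! ### Sub-Gaussianity of linear functionals of the noise. -/

open ProbabilityTheory in
-- Fatou's lemma applied to the positive variables exp(tXₙ); no uniform integrability is needed.
theorem HasSubgaussianMGF.of_tendsto_ae {Ω : Type*} [MeasurableSpace Ω] {P : Measure Ω}
    {X : ℕ → Ω → ℝ} {Y : Ω → ℝ} {c : ℕ → NNReal} {d : NNReal}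
    (hX : ∀ n, HasSubgaussianMGF (X n) (c n) P)
    (hlim : ∀ᵐ ω ∂P, Tendsto (fun n => X n ω) atTop (𝓝 (Y ω)))
    (hc : Tendsto c atTop (𝓝 d)) : HasSubgaussianMGF Y d P := by
  have hYm : AEMeasurable Y P :=
    aemeasurable_of_tendsto_metrizable_ae atTop (fun n => (hX n).aemeasurable) hlim
  have key : ∀ t : ℝ, ∫⁻ ω, ENNReal.ofReal (Real.exp (t * Y ω)) ∂P ≤
      ENNReal.ofReal (Real.exp (d * t ^ 2 / 2)) := by
    intro t
    have h1 : ∀ᵐ ω ∂P, ENNReal.ofReal (Real.exp (t * Y ω)) ≤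
        liminf (fun n => ENNReal.ofReal (Real.exp (t * X n ω))) atTop := by
      filter_upwards [hlim] with ω hω
      have : Tendsto (fun n => ENNReal.ofReal (Real.exp (t * X n ω))) atTop
          (𝓝 (ENNReal.ofReal (Real.exp (t * Y ω)))) :=
        ENNReal.tendsto_ofReal ((Real.continuous_exp.tendsto _).comp (hω.const_mul t))
      exact this.liminf_eq.ge
    have h2 : Tendsto (fun n => ENNReal.ofReal (Real.exp (c n * t ^ 2 / 2))) atTop
        (𝓝 (ENNReal.ofReal (Real.exp (d * t ^ 2 / 2)))) := by
      refine ENNReal.tendsto_ofReal ((Real.continuous_exp.tendsto _).comp ?_)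
      exact ((((NNReal.continuous_coe.tendsto d).comp hc).mul_const _).div_const _)
    calc _ ≤ ∫⁻ ω, liminf (fun n => ENNReal.ofReal (Real.exp (t * X n ω))) atTop ∂P :=
          lintegral_mono_ae h1
      _ ≤ liminf (fun n => ∫⁻ ω, ENNReal.ofReal (Real.exp (t * X n ω)) ∂P) atTop :=
          lintegral_liminf_le' fun n => ((hX n).integrable_exp_mul t).1.aemeasurable.ennreal_ofReal
      _ ≤ liminf (fun n => ENNReal.ofReal (Real.exp (c n * t ^ 2 / 2))) atTop := by
          refine liminf_le_liminf (Eventually.of_forall fun n => ?_)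
          rw [← ofReal_integral_eq_lintegral_ofReal ((hX n).integrable_exp_mul t)
            (Eventually.of_forall fun _ => (Real.exp_pos _).le)]
          exact ENNReal.ofReal_le_ofReal ((hX n).mgf_le t)
      _ = _ := h2.liminf_eq
  have hm : ∀ t : ℝ, AEStronglyMeasurable (fun ω => Real.exp (t * Y ω)) P := fun t =>
    (hYm.const_mul t).exp.aestronglyMeasurable
  refine ⟨fun t => ⟨hm t, ?_⟩, fun t => ?_⟩
  · rw [hasFiniteIntegral_iff_ofReal (Eventually.of_forall fun _ => (Real.exp_pos _).le)]
    exact (key t).trans_lt ENNReal.ofReal_lt_top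
  · rw [mgf, integral_eq_lintegral_of_nonneg_ae (Eventually.of_forall fun _ => (Real.exp_pos _).le)
      (hm t)]
    exact ENNReal.toReal_le_of_le_ofReal (Real.exp_pos _).le (key t)

open ProbabilityTheory in
theorem HasSubgaussianMGF.mono {Ω : Type*} [MeasurableSpace Ω] {P : Measure Ω} {Y : Ω → ℝ}
    {c d : NNReal} (h : HasSubgaussianMGF Y c P) (hcd : c ≤ d) : HasSubgaussianMGF Y d P :=
  ⟨h.integrable_exp_mul, fun t => (h.mgf_le t).trans <| Real.exp_le_exp.2 <| by
    have : (c : ℝ) ≤ d := hcd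
    gcongr⟩

theorem integral_sq_sum {α ι : Type*} [MeasurableSpace α] {μ : Measure α} (s : Finset ι)
    (c : ι → ℝ) {f : ι → α → ℝ} (hf : ∀ i, MemLp (f i) 2 μ) :
    ∫ x, (∑ i ∈ s, c i * f i x) ^ 2 ∂μ =
      ∑ i ∈ s, ∑ j ∈ s, c i * c j * ∫ x, f i x * f j x ∂μ := by
  have hint : ∀ i j, Integrable (fun x => c i * c j * (f i x * f j x)) μ := fun i j =>
    ((hf i).integrable_mul (hf j)).const_mul _
  have : ∀ x, (∑ i ∈ s, c i * f i x) ^ 2 = ∑ i ∈ s, ∑ j ∈ s, c i * c j * (f i x * f j x) := by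
    intro x
    rw [sq, Finset.sum_mul_sum]
    exact Finset.sum_congr rfl fun i _ => Finset.sum_congr rfl fun j _ => by ring
  simp only [this]
  rw [integral_finsetSum _ fun i _ => integrable_finsetSum _ fun j _ => hint i j]
  refine Finset.sum_congr rfl fun i _ => ?_
  rw [integral_finsetSum _ fun j _ => hint i j]
  exact Finset.sum_congr rfl fun j _ => integral_const_mul _ _

open ProbabilityTheory in
/-- A finite linear combination of the values of a jointly strictly sub-Gaussian process. -/
theorem IsJointlyStrictlySubGaussian.hasSubgaussianMGF_sum {Ω : Type*} [MeasurableSpace Ω]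
    {P : Measure Ω} {ξ : ℝ → Ω → ℝ} (hξ : IsJointlyStrictlySubGaussian P ξ) {ι : Type*}
    (s : Finset ι) (w t : ι → ℝ) :
    HasSubgaussianMGF (fun ω => ∑ i ∈ s, w i * ξ (t i) ω)
      (Real.toNNReal (∫ ω, (∑ i ∈ s, w i * ξ (t i) ω) ^ 2 ∂P)) P := by
  have hL2 : ∀ r, MemLp (ξ r) 2 P := fun r => (hξ 1 fun _ => r).1 0
  set e := s.equivFin
  have hsum : ∀ h : ι → ℝ, ∑ i ∈ s, h i = ∑ k : Fin s.card, h (e.symm k) := fun h => by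
    rw [← Finset.sum_coe_sort s, ← e.symm.sum_comp]
  have hnn : 0 ≤ ∫ ω, (∑ i ∈ s, w i * ξ (t i) ω) ^ 2 ∂P := integral_nonneg fun _ => sq_nonneg _
  have main (r : ℝ) := (hξ s.card fun k => t (e.symm k)).2 fun k => r * w (e.symm k)
  have hexp (r : ℝ) (ω : Ω) : ∑ k : Fin s.card, ξ (t (e.symm k)) ω * (r * w (e.symm k)) =
      r * ∑ i ∈ s, w i * ξ (t i) ω := by
    rw [hsum, Finset.mul_sum]
    exact Finset.sum_congr rfl fun k _ => by ring
  simp only [hexp] at main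
  refine ⟨fun r => (main r).1, fun r => (main r).2.trans (Real.exp_le_exp.2 (le_of_eq ?_))⟩
  rw [Real.coe_toNNReal _ hnn, integral_sq_sum s w fun i => hL2 (t i)]
  simp only [hsum, Finset.sum_mul, Finset.mul_sum, Finset.sum_div]
  refine Finset.sum_congr rfl fun k _ => Finset.sum_congr rfl fun l _ => ?_
  ring

theorem integral_indicator_Ico_mul (a b c d : ℝ) (hab : a ≤ b) (hcd : c ≤ d) :
    ∫ x, (Set.Ico a b).indicator (fun _ => (1 : ℝ)) x * (Set.Ico c d).indicator (fun _ => 1) x =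
      (|b - c| + |a - d| - |a - c| - |b - d|) / 2 := by
  have : ∀ x, (Set.Ico a b).indicator (fun _ => (1 : ℝ)) x *
      (Set.Ico c d).indicator (fun _ => 1) x =
        (Set.Ico (max a c) (min b d)).indicator (fun _ => 1) x := by
    intro x
    rw [← Set.Ico_inter_Ico, ← Set.inter_indicator_mul]
    simp
  simp only [this]
  rw [integral_indicator measurableSet_Ico, setIntegral_const, smul_eq_mul, mul_one,
    Real.volume_real_Ico]
  grind

namespace IsSubGaussianIntegratedWhiteNoise

variable {Ω : Type*} [MeasurableSpace Ω] {P : Measure Ω} {ξ : ℝ → Ω → ℝ}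

theorem memLp_sub (h : IsSubGaussianIntegratedWhiteNoise P ξ) (a b : ℝ) :
    MemLp (fun ω => ξ b ω - ξ a ω) 2 P :=
  (h.meanSquareContinuous.1 b).sub (h.meanSquareContinuous.1 a)

theorem integral_sq_sub (h : IsSubGaussianIntegratedWhiteNoise P ξ) (a b : ℝ) :
    ∫ ω, (ξ b ω - ξ a ω) ^ 2 ∂P = |b - a| := by
  have key : ∀ a b : ℝ, a < b → ∫ ω, (ξ b ω - ξ a ω) ^ 2 ∂P = b - a := fun a b hab => by
    have := h.increment_variance a (b - a) (by linarith)
    simpa using this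
  rcases lt_trichotomy a b with hab | rfl | hab
  · rw [key a b hab, abs_of_pos (by linarith)]
  · simp
  · rw [abs_of_neg (by linarith), neg_sub, ← key b a hab]
    congr 1; ext ω; ring

/-- Polarization: the product of two increments is a combination of four squared increments, whose
means are lengths. The indicators of the intervals have the same inner products by
`integral_indicator_Ico_mul`, which is the isometry of the stochastic integral. -/
theorem integral_sub_mul_sub (h : IsSubGaussianIntegratedWhiteNoise P ξ) (a b c d : ℝ) :
    ∫ ω, (ξ b ω - ξ a ω) * (ξ d ω - ξ c ω) ∂P =
      (|b - c| + |a - d| - |a - c| - |b - d|) / 2 := by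
  have hi (x y : ℝ) : Integrable (fun ω => (ξ y ω - ξ x ω) ^ 2) P := (h.memLp_sub x y).integrable_sq
  have e : ∀ ω, (ξ b ω - ξ a ω) * (ξ d ω - ξ c ω) = ((ξ b ω - ξ c ω) ^ 2 + (ξ a ω - ξ d ω) ^ 2 -
      (ξ a ω - ξ c ω) ^ 2 - (ξ b ω - ξ d ω) ^ 2) / 2 := fun ω => by ring
  simp only [e]
  rw [integral_div, integral_sub (by exact ((hi c b).add (hi d a)).sub (hi c a)) (hi d b),
    integral_sub (by exact (hi c b).add (hi d a)) (hi c a), integral_add (hi c b) (hi d a)]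
  simp only [h.integral_sq_sub]

open ProbabilityTheory in
-- A step integral is a linear combination of values of `ξ`, with coefficients `c` at `β` and `-c`
-- at `α` (the `Bool` index). Its proxy is its variance, and the matching Gram matrices turn that
-- into an `L²(ℝ)` norm.
theorem hasSubgaussianMGF_step (h : IsSubGaussianIntegratedWhiteNoise P ξ) {ι : Type*}
    (s : Finset ι) (c α β : ι → ℝ) (hαβ : ∀ i, α i ≤ β i) :
    HasSubgaussianMGF (fun ω => ∑ i ∈ s, c i * (ξ (β i) ω - ξ (α i) ω))
      (Real.toNNReal
        (∫ x, (∑ i ∈ s, c i * (Set.Ico (α i) (β i)).indicator (fun _ => (1 : ℝ)) x) ^ 2)) P := by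
  have h1 := h.jointlyStrictlySubGaussian.hasSubgaussianMGF_sum (s ×ˢ (Finset.univ : Finset Bool))
    (fun p => if p.2 then c p.1 else - c p.1) (fun p => if p.2 then β p.1 else α p.1)
  simp only [Finset.sum_product, Fintype.sum_bool, if_true, Bool.false_eq_true, if_false] at h1
  have e : ∀ ω, ∑ i ∈ s, (c i * ξ (β i) ω + -c i * ξ (α i) ω) =
      ∑ i ∈ s, c i * (ξ (β i) ω - ξ (α i) ω) := fun ω =>
    Finset.sum_congr rfl fun i _ => by ring
  simp only [e] at h1
  rw [integral_sq_sum s c fun i => h.memLp_sub (α i) (β i)] at h1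
  rw [integral_sq_sum s c fun i => memLp_indicator_const 2 measurableSet_Ico 1 (Or.inr (by simp))]
  simpa only [h.integral_sub_mul_sub, integral_indicator_Ico_mul _ _ _ _ (hαβ _) (hαβ _)] using h1

end IsSubGaussianIntegratedWhiteNoise

theorem tendsto_integral_sq_of_tendsto_eLpNorm {α : Type*} [MeasurableSpace α] {μ : Measure α}
    {f : α → ℝ} {g : ℕ → α → ℝ} (hf : MemLp f 2 μ) (hg : ∀ n, MemLp (g n) 2 μ)
    (h : Tendsto (fun n => eLpNorm (fun x => f x - g n x) 2 μ) atTop (𝓝 0)) :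
    Tendsto (fun n => ∫ x, g n x ^ 2 ∂μ) atTop (𝓝 (∫ x, f x ^ 2 ∂μ)) := by
  have key : ∀ {k : α → ℝ} (hk : MemLp k 2 μ), ∫ x, k x ^ 2 ∂μ = ‖hk.toLp k‖ ^ 2 := by
    intro k hk
    rw [← real_inner_self_eq_norm_sq, L2.inner_def]
    refine integral_congr_ae ?_
    filter_upwards [hk.coeFn_toLp] with x hx
    simp [hx, sq]
  have hl : Tendsto (fun n => (hg n).toLp (g n)) atTop (𝓝 (hf.toLp f)) := by
    rw [Lp.tendsto_Lp_iff_tendsto_eLpNorm'' g hg f hf]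
    refine h.congr fun n => ?_
    exact eLpNorm_sub_comm f (g n) 2 μ
  simp only [key hf, key (hg _)]
  exact (hl.norm).pow 2

theorem tendsto_eLpNorm_sum_sub {α ι : Type*} [MeasurableSpace α] {μ : Measure α} (s : Finset ι)
    (w : ι → ℝ) {f : ι → α → ℝ} {g : ι → ℕ → α → ℝ}
    (hm : ∀ i n, AEStronglyMeasurable (fun x => f i x - g i n x) μ)
    (h : ∀ i, Tendsto (fun n => eLpNorm (fun x => f i x - g i n x) 2 μ) atTop (𝓝 0)) :
    Tendsto (fun n => eLpNorm (fun x => ∑ i ∈ s, w i * f i x - ∑ i ∈ s, w i * g i n x) 2 μ) atTop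
      (𝓝 0) := by
  have hb : ∀ n, eLpNorm (fun x => ∑ i ∈ s, w i * f i x - ∑ i ∈ s, w i * g i n x) 2 μ ≤
      ∑ i ∈ s, ‖w i‖ₑ * eLpNorm (fun x => f i x - g i n x) 2 μ := by
    intro n
    have e : (fun x => ∑ i ∈ s, w i * f i x - ∑ i ∈ s, w i * g i n x) =
        ∑ i ∈ s, w i • fun x => f i x - g i n x := by
      ext x
      simp only [Finset.sum_apply, Pi.smul_apply, smul_eq_mul, ← Finset.sum_sub_distrib, mul_sub]
    rw [e]
    refine (eLpNorm_sum_le (fun i _ => (hm i n).const_smul (w i)) (by norm_num)).trans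
      (le_of_eq (Finset.sum_congr rfl fun i _ => ?_))
    rw [eLpNorm_const_smul]
  have hz : Tendsto (fun n => ∑ i ∈ s, ‖w i‖ₑ * eLpNorm (fun x => f i x - g i n x) 2 μ) atTop
      (𝓝 0) := by
    have := tendsto_finsetSum s fun i _ =>
      ENNReal.Tendsto.const_mul (a := ‖w i‖ₑ) (h i) (Or.inr enorm_ne_top)
    simpa using this
  exact tendsto_of_tendsto_of_tendsto_of_le_of_le tendsto_const_nhds hz (fun _ => zero_le) hb

theorem SimpleStep.memLp_eval (g : SimpleStep) : MemLp g.eval 2 volume := by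
  have : g.eval = fun x => ∑ l, (Set.Ico (g.α l) (g.β l)).indicator (fun _ => g.c l) x := rfl
  rw [this]
  exact memLp_finsetSum _ fun l _ => memLp_indicator_const 2 measurableSet_Ico _ (Or.inr (by simp))

theorem SimpleStep.eval_eq (g : SimpleStep) (x : ℝ) :
    g.eval x = ∑ l, g.c l * (Set.Ico (g.α l) (g.β l)).indicator (fun _ => (1 : ℝ)) x :=
  Finset.sum_congr rfl fun l _ => by by_cases h : x ∈ Set.Ico (g.α l) (g.β l) <;> simp [h]

open ProbabilityTheory in
/-- A finite linear combination of values of the filtered white noise is sub-Gaussian, with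
variance proxy given by the `L²` norm of the corresponding combination of kernels. -/
theorem IsFilteredWhiteNoise.hasSubgaussianMGF_sum {Ω : Type*} [MeasurableSpace Ω]
    {P : Measure Ω} {ψ : ℝ → ℝ} {ξ ε : ℝ → Ω → ℝ} (h : IsFilteredWhiteNoise P ψ ξ ε)
    (hε : ∀ t, Measurable (ε t)) {ι : Type*} (s : Finset ι) (w t : ι → ℝ) :
    HasSubgaussianMGF (fun ω => ∑ i ∈ s, w i * ε (t i) ω)
      (Real.toNNReal (∫ x, (∑ i ∈ s, w i * ψ (t i - x)) ^ 2)) P := by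
  choose g hg1 hg2 using fun i => h.eq_integral (t i)
  have hψ : ∀ r, MemLp (fun x => ψ (r - x)) 2 volume := fun r =>
    h.sq_integrable.comp_measurePreserving (Measure.measurePreserving_sub_left volume r)
  have hmi : ∀ (g : SimpleStep), Measurable (g.integral ξ) := fun g => by
    have := h.noise.measurable
    unfold SimpleStep.integral
    fun_prop
  have l1 := tendsto_eLpNorm_sum_sub s w (fun i n => by
    exact ((hψ (t i)).sub (g i n).memLp_eval).1) hg1
  have l2 := tendsto_eLpNorm_sum_sub s w (fun i n => by
    exact ((hε (t i)).sub (hmi (g i n))).aestronglyMeasurable) hg2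
  have hvar := tendsto_integral_sq_of_tendsto_eLpNorm
    (memLp_finsetSum s fun i _ => (hψ (t i)).const_mul (w i))
    (fun n => memLp_finsetSum s fun i _ => (g i n).memLp_eval.const_mul (w i)) l1
  have hmeas : TendstoInMeasure P (fun n ω => ∑ i ∈ s, w i * (g i n).integral ξ ω) atTop
      fun ω => ∑ i ∈ s, w i * ε (t i) ω := by
    refine tendstoInMeasure_of_tendsto_eLpNorm (p := 2) (by norm_num) (fun n => ?_) ?_ ?_
    · exact (Finset.measurable_fun_sum _ fun i _ => (hmi _).const_mul _).aestronglyMeasurable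
    · exact (Finset.measurable_fun_sum _ fun i _ => (hε _).const_mul _).aestronglyMeasurable
    · refine l2.congr fun n => ?_
      exact eLpNorm_sub_comm (fun ω => ∑ i ∈ s, w i * ε (t i) ω)
        (fun ω => ∑ i ∈ s, w i * (g i n).integral ξ ω) 2 P
  -- Mean-square convergence gives almost sure convergence only along a subsequence, which suffices
  -- because the variances converge along it too.
  obtain ⟨ns, hns, hae⟩ := hmeas.exists_seq_tendsto_ae
  refine HasSubgaussianMGF.of_tendsto_ae (fun k => ?_) hae
    ((continuous_real_toNNReal.tendsto _).comp (hvar.comp hns.tendsto_atTop))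
  -- The weighted sum of several step integrals is one step integral, indexed by pairs (time point,
  -- step).
  have hs := h.noise.hasSubgaussianMGF_step (s.sigma fun i => (Finset.univ : Finset (Fin (g i (ns k)).r)))
    (fun p => w p.1 * (g p.1 (ns k)).c p.2) (fun p => (g p.1 (ns k)).α p.2)
    (fun p => (g p.1 (ns k)).β p.2) (fun p => (g p.1 (ns k)).α_le_β p.2)
  simp only [Finset.sum_sigma] at hs
  simp only [SimpleStep.integral, Function.comp_apply, SimpleStep.eval_eq, Finset.mul_sum,
    ← mul_assoc]
  exact hs

open ProbabilityTheory in
/-- The weighted integral of the noise is sub-Gaussian, with the variance proxy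
`2π f₀ ∫₀ᵀ f²`. -/
theorem IsFilteredWhiteNoise.hasSubgaussianMGF_integral {Ω : Type*} [MeasurableSpace Ω]
    {P : Measure Ω} {ψ : ℝ → ℝ} {ξ ε : ℝ → Ω → ℝ} (h : IsFilteredWhiteNoise P ψ ξ ε)
    (hε : IsCentredContinuousNoise P ε) (hsup : spectralSup ψ h.sq_integrable < ⊤)
    {f : ℝ → ℝ} {T : ℝ} (hT : 0 < T) (hf : ContinuousOn f (Set.Icc 0 T)) :
    HasSubgaussianMGF (fun ω => ∫ t in (0 : ℝ)..T, f t * ε t ω)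
      (Real.toNNReal (2 * Real.pi * (spectralSup ψ h.sq_integrable).toReal *
        ∫ t in (0 : ℝ)..T, f t ^ 2)) P := by
  obtain ⟨v, hv, hlim⟩ := exists_tendsto_integral_sq_riemann_sum_filter h.sq_integrable
    (ae_norm_sq_fourier_le_spectralSup h.sq_integrable hsup) hT hf
  refine HasSubgaussianMGF.mono ?_ (Real.toNNReal_le_toNNReal hv)
  refine HasSubgaussianMGF.of_tendsto_ae (fun n => h.hasSubgaussianMGF_sum hε.measurable
    (Finset.range n) (fun k => T / n * f (k * (T / n))) (fun k => k * (T / n))) ?_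
    ((continuous_real_toNNReal.tendsto _).comp hlim)
  filter_upwards [hε.ae_continuous] with ω hω
  refine (tendsto_riemann_sum hT (hf.mul hω.continuousOn)).congr fun n => ?_
  exact Finset.sum_congr rfl fun k _ => by
    simp only [smul_eq_mul, Pi.mul_apply]; ring

/-! ### Separated nets and Gaussian sums over them. -/

/-- A separated subset of maximal cardinality is a net. It is finite because the packing number at
scale `r` is at most the external covering number at scale `r / 2`. -/
theorem exists_finset_separated_net {V : Type*} [MetricSpace V] {U : Set V}
    (hU : TotallyBounded U) {r : ℝ} (hr : 0 < r) :
    ∃ N : Finset V, ↑N ⊆ U ∧ (∀ x ∈ N, ∀ y ∈ N, x ≠ y → r < dist x y) ∧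
      ∀ u ∈ U, ∃ x ∈ N, dist u x ≤ r := by
  set ε : NNReal := ⟨r, hr.le⟩ with hε
  have hε2 : ε / 2 ≠ 0 := by
    have : ε ≠ 0 := fun h => hr.ne' (congrArg NNReal.toReal h)
    simpa using this
  have hp : Metric.packingNumber ε U ≠ ⊤ := by
    obtain ⟨C, -, hC, hcov⟩ := Metric.exists_finite_isCover_of_totallyBounded hε2 hU
    have h1 := Metric.packingNumber_two_mul_le_externalCoveringNumber (ε / 2) U
    rw [mul_div_cancel₀ _ two_ne_zero] at h1
    exact ((h1.trans hcov.externalCoveringNumber_le_encard).trans_lt hC.encard_lt_top).ne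
  have hfin : (Metric.maximalSeparatedSet ε U).Finite := by
    rw [← Set.encard_ne_top_iff, Metric.encard_maximalSeparatedSet hp]
    exact hp
  refine ⟨hfin.toFinset, by simpa using Metric.maximalSeparatedSet_subset, fun x hx y hy hxy => ?_,
    fun u hu => ?_⟩
  · have hlt : (ε : ℝ≥0∞) < edist x y := Metric.isSeparated_maximalSeparatedSet (ε := ε) (A := U)
      (hfin.mem_toFinset.1 hx) (hfin.mem_toFinset.1 hy) hxy
    rw [edist_nndist, ENNReal.coe_lt_coe] at hlt
    exact NNReal.coe_lt_coe.2 hlt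
  · obtain ⟨x, hx, hux⟩ := (Metric.isCover_maximalSeparatedSet hp) hu
    refine ⟨x, hfin.mem_toFinset.2 hx, ?_⟩
    have hux' : edist u x ≤ ε := hux
    rw [edist_nndist, ENNReal.coe_le_coe] at hux'
    exact NNReal.coe_le_coe.2 hux'

theorem integrable_exp_neg_mul_norm_sq {V : Type*} [NormedAddCommGroup V] [InnerProductSpace ℝ V]
    [FiniteDimensional ℝ V] [MeasurableSpace V] [BorelSpace V] {c : ℝ} (hc : 0 < c) :
    Integrable fun v : V => Real.exp (-c * ‖v‖ ^ 2) := by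
  have := (GaussianFourier.integrable_cexp_neg_mul_sq_norm_add (V := V) (b := c) (by simpa) 0 0).re
  refine this.congr (Eventually.of_forall fun v => ?_)
  simp only [zero_mul, add_zero]
  norm_cast

/-- The sum of a Gaussian function over an `r`-separated finite set is `O(r^{-q})`. -/
theorem exists_sum_exp_le_of_separated {V : Type*} [NormedAddCommGroup V] [InnerProductSpace ℝ V]
    [FiniteDimensional ℝ V] [MeasurableSpace V] [BorelSpace V] {c : ℝ} (hc : 0 < c) :
    ∃ C : ℝ, 0 ≤ C ∧ ∀ r : ℝ, 0 < r → r ≤ 1 → ∀ N : Finset V,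
      (∀ x ∈ N, ∀ y ∈ N, x ≠ y → r < dist x y) →
        ∑ x ∈ N, Real.exp (-c * ‖x‖ ^ 2) ≤ C * (r⁻¹) ^ Module.finrank ℝ V := by
  set n := Module.finrank ℝ V
  set v₁ : ℝ := (volume : Measure V).real (Metric.ball 0 1)
  have hv₁ : 0 < v₁ := ENNReal.toReal_pos (Metric.measure_ball_pos _ _ one_pos).ne'
    measure_ball_lt_top.ne
  set I := ∫ y : V, Real.exp (-(c / 2) * ‖y‖ ^ 2)
  have hint : Integrable fun y : V => Real.exp (-(c / 2) * ‖y‖ ^ 2) :=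
    integrable_exp_neg_mul_norm_sq (by positivity)
  have hI : 0 ≤ I := integral_nonneg fun _ => (Real.exp_pos _).le
  refine ⟨Real.exp (c / 2) * I * 2 ^ n / v₁, by positivity, fun r hr hr1 N hN => ?_⟩
  have hvol : ∀ x : V, (volume : Measure V).real (Metric.ball x (r / 2)) = (r / 2) ^ n * v₁ := by
    intro x
    rw [Measure.real, Measure.addHaar_ball_of_pos _ _ (by positivity), ENNReal.toReal_mul,
      ENNReal.toReal_ofReal (by positivity)]
    rfl
  -- On a ball of radius at most 1/2 about `x` one has ‖y‖² ≤ 2‖x‖² + 1, so each term is dominated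
  -- by the average of a wider Gaussian over its ball. Separation makes the balls disjoint.
  have hone : ∀ x ∈ N, Real.exp (-c * ‖x‖ ^ 2) * ((r / 2) ^ n * v₁) ≤
      Real.exp (c / 2) * ∫ y in Metric.ball x (r / 2), Real.exp (-(c / 2) * ‖y‖ ^ 2) := by
    intro x _
    rw [← hvol x, ← smul_eq_mul, smul_eq_mul, mul_comm, ← smul_eq_mul, ← setIntegral_const,
      ← integral_const_mul]
    refine setIntegral_mono_on (integrableOn_const measure_ball_lt_top.ne)
      (hint.const_mul _).integrableOn measurableSet_ball fun y hy => ?_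
    rw [← Real.exp_add, Real.exp_le_exp]
    have h1 : ‖y‖ ≤ ‖x‖ + 1 / 2 := by
      have h2 : ‖y - x‖ < r / 2 := by rwa [mem_ball_iff_norm] at hy
      have h3 : ‖y‖ ≤ ‖x‖ + ‖y - x‖ := by simpa using norm_add_le x (y - x)
      linarith
    have h2 : ‖y‖ ^ 2 ≤ 2 * ‖x‖ ^ 2 + 1 := by
      nlinarith [norm_nonneg y, norm_nonneg x, sq_nonneg (‖x‖ - 1 / 2),
        mul_self_le_mul_self (norm_nonneg y) h1]
    nlinarith
  have hdisj : (↑N : Set V).Pairwise (Function.onFun Disjoint fun x => Metric.ball x (r / 2)) := by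
    intro x hx y hy hxy
    exact Metric.ball_disjoint_ball (by linarith [hN x hx y hy hxy])
  have hsum : (∑ x ∈ N, Real.exp (-c * ‖x‖ ^ 2)) * ((r / 2) ^ n * v₁) ≤ Real.exp (c / 2) * I := by
    rw [Finset.sum_mul]
    refine (Finset.sum_le_sum hone).trans ?_
    rw [← Finset.mul_sum, ← integral_biUnion_finset N (fun x _ => measurableSet_ball) hdisj
      fun x _ => hint.integrableOn]
    gcongr
    exact setIntegral_le_integral hint (Eventually.of_forall fun _ => (Real.exp_pos _).le)
  rw [← le_div_iff₀ (by positivity)] at hsum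
  refine hsum.trans (le_of_eq ?_)
  rw [div_pow, inv_pow]
  field_simp

/-! ### Chaining and large deviations of a sub-Gaussian field. -/

/-- Chaining along a sequence of nets: a point of the `M`-th net is either connected to the coarsest
net by small increments of `g`, or some link of its chain carries a large increment. -/
theorem chaining_dichotomy {V : Type*} [PseudoMetricSpace V] {N : ℕ → Finset V} {p : ℕ → V → V}
    {e w : ℕ → ℝ} (hp : ∀ n, ∀ x ∈ N (n + 1), p n x ∈ N n) (he : ∀ n, 0 ≤ e n)
    (hpe : ∀ n, ∀ x ∈ N (n + 1), dist x (p n x) ≤ e n) (g : V → ℝ) (a : ℝ) (M : ℕ) :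
    ∀ u ∈ N M, (∃ x ∈ N 0, dist u x ≤ ∑ n ∈ Finset.range M, e n ∧
        g u ≤ g x + a * ∑ n ∈ Finset.range M, w n) ∨
      ∃ n, ∃ x ∈ N (n + 1), dist u x ≤ ∑ n ∈ Finset.range M, e n ∧
        g (p n x) + a * w n < g x := by
  induction M with
  | zero => exact fun u hu => Or.inl ⟨u, hu, by simp⟩
  | succ M ih =>
    intro u hu
    by_cases hlarge : g (p M u) + a * w M < g u
    · refine Or.inr ⟨M, u, hu, ?_, hlarge⟩
      rw [dist_self]
      exact Finset.sum_nonneg fun n _ => he n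
    · have hd := hpe M u hu
      rw [Finset.sum_range_succ, Finset.sum_range_succ]
      rcases ih (p M u) (hp M u hu) with ⟨x, hx, h1, h2⟩ | ⟨n, x, hx, h1, h2⟩
      · refine Or.inl ⟨x, hx, ?_, ?_⟩
        · linarith [dist_triangle u (p M u) x]
        · rw [mul_add]; linarith
      · refine Or.inr ⟨n, x, hx, ?_, h2⟩
        linarith [dist_triangle u (p M u) x]

/-- A chaining link `x` whose increment exceeds its share of `Φ / 32` has exponentially small
probability. -/
theorem link_exponent_le {c₀ c₁ s2 b d R y : ℝ} {n : ℕ} (hc₀ : 0 < c₀) (hc₁ : 0 < c₁)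
    (hs2 : 0 < s2) (hb : 0 < b) (hd : 0 < d) (hdK : 2 ^ 22 * s2 * c₁ * b * d ^ 2 ≤ c₀ ^ 2)
    (hR : 1 ≤ R) :
    -((1 / 32 * c₀ * ((R ^ 2 + y ^ 2 / 4) / 2) * (1 / 4 * (3 / 4) ^ n) / 2) ^ 2) /
        (2 * (s2 * (c₁ * (d * (1 / 2) ^ n) ^ 2))) ≤
      -b * R ^ 2 + -b * 2 ^ n + -(b / 4) * y ^ 2 := by
  have hpow1 : ((3 / 4 : ℝ) ^ n) ^ 2 = (9 / 16) ^ n := by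
    rw [← pow_mul, mul_comm, pow_mul]; norm_num
  have hpow2 : (2 : ℝ) ^ n * ((1 / 2 : ℝ) ^ n) ^ 2 = (1 / 2) ^ n := by
    rw [sq, ← mul_assoc, ← mul_pow]; norm_num
  -- Thresholds shrink like (3/4)ⁿ and distances like (1/2)ⁿ. The exponent therefore grows like
  -- (9/4)ⁿ, enough for the factor 2ⁿ that beats the size of the nets.
  have hpow3 : (1 / 2 : ℝ) ^ n ≤ (9 / 16) ^ n := pow_le_pow_left₀ (by norm_num) (by norm_num) n
  have hone : (1 : ℝ) ≤ 2 ^ n := one_le_pow₀ (by norm_num)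
  have hR2 : 1 ≤ R ^ 2 := one_le_pow₀ hR
  set m := (R ^ 2 + y ^ 2 / 4) / 2 with hm
  have hm2 : 1 / 2 ≤ m := by nlinarith [sq_nonneg y]
  have key : 16 * b * 2 ^ n * m ≤
      (1 / 32 * c₀ * m * (1 / 4 * (3 / 4) ^ n) / 2) ^ 2 /
        (2 * (s2 * (c₁ * (d * (1 / 2) ^ n) ^ 2))) := by
    rw [le_div_iff₀ (by positivity)]
    calc 16 * b * 2 ^ n * m * (2 * (s2 * (c₁ * (d * (1 / 2) ^ n) ^ 2)))
        = 2 ^ 22 * s2 * c₁ * b * d ^ 2 * m * (2 ^ n * ((1 / 2 : ℝ) ^ n) ^ 2) / 2 ^ 17 := by ring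
      _ = 2 ^ 22 * s2 * c₁ * b * d ^ 2 * m * (1 / 2) ^ n / 2 ^ 17 := by rw [hpow2]
      _ ≤ c₀ ^ 2 * m * (9 / 16) ^ n / 2 ^ 17 := by gcongr
      _ ≤ c₀ ^ 2 * m * (9 / 16) ^ n / 2 ^ 17 * (2 * m) :=
          le_mul_of_one_le_right (by positivity) (by linarith)
      _ = _ := by rw [← hpow1]; ring
  rw [neg_div]
  have h1 : b * (2 ^ n * R ^ 2) ≥ b * R ^ 2 := by
    have : R ^ 2 ≤ 2 ^ n * R ^ 2 := le_mul_of_one_le_left (by positivity) hone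
    gcongr
  have h2 : b * (2 ^ n * R ^ 2) ≥ b * 2 ^ n := by
    have : (2 : ℝ) ^ n ≤ 2 ^ n * R ^ 2 := le_mul_of_one_le_right (by positivity) hR2
    gcongr
  have h3 : b * (2 ^ n * y ^ 2) ≥ b * y ^ 2 := by
    have : y ^ 2 ≤ 2 ^ n * y ^ 2 := le_mul_of_one_le_left (by positivity) hone
    gcongr
  have h4 : 16 * b * 2 ^ n * m = 8 * (b * (2 ^ n * R ^ 2)) + 2 * (b * (2 ^ n * y ^ 2)) := by
    rw [hm]; ring
  have h5 : 0 ≤ b * R ^ 2 := by positivity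
  have h6 : 0 ≤ b * y ^ 2 := by positivity
  linarith

open ProbabilityTheory in
/-- Large deviations of a sub-Gaussian field against its own variance: the bound depends only on the
dimension and on the constants comparing the variance `Φ` with the squared distance. -/
theorem exists_tail_bound {Ω : Type*} [MeasurableSpace Ω] (P : Measure Ω) [IsProbabilityMeasure P]
    (V : Type*) [NormedAddCommGroup V] [InnerProductSpace ℝ V] [FiniteDimensional ℝ V]
    [MeasurableSpace V] [BorelSpace V] {c₀ c₁ s2 b : ℝ} (hc₀ : 0 < c₀) (hc₁ : 0 < c₁)
    (hs2 : 0 < s2) (hb : 0 < b) (hbc : 16 * b * s2 ≤ c₀) :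
    ∃ B : ℝ, 0 < B ∧ ∀ (U : Set V) (Φ : V → V → ℝ) (η : V → Ω → ℝ),
      TotallyBounded U → (0 : V) ∈ U →
      (∀ u ∈ U, ∀ v ∈ U, c₀ * ‖u - v‖ ^ 2 ≤ Φ u v ∧ Φ u v ≤ c₁ * ‖u - v‖ ^ 2) →
      (∀ u ∈ U, ∀ v ∈ U, ∀ r : ℝ, 0 < r → Φ v 0 ≤ (1 + r) * Φ u 0 + (1 + r⁻¹) * Φ v u) →
      (∀ u ∈ U, ∀ v ∈ U, HasSubgaussianMGF (fun ω => η u ω - η v ω) (s2 * Φ u v).toNNReal P) →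
      (∀ ω, η 0 ω = 0) →
      (∀ᵐ ω ∂P, ContinuousOn (fun u => η u ω) U) →
      ∀ R : ℝ, 1 ≤ R →
        P.real {ω | ∃ u ∈ U, R ≤ ‖u‖ ∧ Φ u 0 ≤ 2 * η u ω} ≤ B * Real.exp (-b * R ^ 2) := by
  set q := Module.finrank ℝ V
  obtain ⟨C, hC0, hC⟩ := exists_sum_exp_le_of_separated (V := V) (c := b / 4) (by positivity)
  -- A chain moves a point by at most `3 * d`. The first bound makes this at most 1/32 ≤ R/32, the
  -- second makes 33 c₁ (3d)² ≤ c₀/32, and the third is what `link_exponent_le` requires.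
  obtain ⟨d, hd, hd1, hd2, hd3⟩ : ∃ d : ℝ, 0 < d ∧ d ≤ 1 / 96 ∧ 9504 * c₁ * d ^ 2 ≤ c₀ ∧
      2 ^ 22 * s2 * c₁ * b * d ^ 2 ≤ c₀ ^ 2 := by
    have hlim : ∀ K : ℝ, Tendsto (fun d : ℝ => K * d ^ 2) (𝓝[>] 0) (𝓝 0) := fun K => by
      have : Continuous fun d : ℝ => K * d ^ 2 := by fun_prop
      simpa using (this.tendsto 0).mono_left nhdsWithin_le_nhds
    have hid : Tendsto (fun d : ℝ => d) (𝓝[>] 0) (𝓝 0) := nhdsWithin_le_nhds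
    have := (eventually_mem_nhdsWithin (a := (0 : ℝ)) (s := Set.Ioi 0)).and
      ((hid.eventually_le_const (by norm_num : (0 : ℝ) < 1 / 96)).and
      (((hlim (9504 * c₁)).eventually_le_const hc₀).and
      ((hlim (2 ^ 22 * s2 * c₁ * b)).eventually_le_const (by positivity : 0 < c₀ ^ 2))))
    exact this.exists
  have hsummable : Summable fun n : ℕ =>
      C * Real.exp (-b * 2 ^ n) * ((d * (1 / 2) ^ (n + 1))⁻¹) ^ q := by
    -- The series is, up to a constant, the subseries of ∑ m^q exp(-bm) over m = 2ⁿ.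
    have h1 := (Real.summable_pow_mul_exp_neg_nat_mul q hb).comp_injective
      (Nat.pow_right_injective le_rfl)
    refine (h1.mul_left (C * (d⁻¹ * 2) ^ q)).congr fun n => ?_
    have h2 : (d * (1 / 2 : ℝ) ^ (n + 1))⁻¹ = d⁻¹ * 2 * 2 ^ n := by
      rw [one_div, inv_pow, mul_inv, inv_inv, pow_succ]; ring
    rw [h2, mul_pow _ ((2 : ℝ) ^ n)]
    simp only [Function.comp_apply, Nat.cast_pow, Nat.cast_ofNat]
    ring
  set S := ∑' n : ℕ, C * Real.exp (-b * 2 ^ n) * ((d * (1 / 2) ^ (n + 1))⁻¹) ^ q with hS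
  have hS0 : 0 ≤ S := tsum_nonneg fun n => by positivity
  refine ⟨C * (d⁻¹) ^ q + S + 1, by positivity, ?_⟩
  intro U Φ η hU h0 hΦ htri hsub hη0 hcont R hR
  have he : ∀ n : ℕ, 0 < d * (1 / 2 : ℝ) ^ n := fun n => by positivity
  choose N hNU hsep hnet using fun n => exists_finset_separated_net hU (he n)
  have hnet' : ∀ n (u : V), ∃ x, u ∈ U → x ∈ N n ∧ dist u x ≤ d * (1 / 2 : ℝ) ^ n := fun n u => by
    by_cases hu : u ∈ U
    · obtain ⟨x, hx⟩ := hnet n u hu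
      exact ⟨x, fun _ => hx⟩
    · exact ⟨u, fun h => absurd h hu⟩
  choose p hp using hnet'
  -- Origin of 15/34: approximation by a net point and the small links each cost Φ(u,0)/32, so 2η(x)
  -- ≥ (30/32) Φ(u,0), while `htri` with `r = 1/32` gives Φ(x,0) ≤ (34/32) Φ(u,0).
  let A : V → Set Ω := fun x => {ω | 15 / 34 * Φ x 0 ≤ η x ω}
  -- The threshold must not depend on the unknown `u`: Φ(u,0) is replaced by a lower bound in `R`
  -- and `‖x‖`, valid since `‖u‖ ≥ R` and `‖x‖ ≤ 2‖u‖`.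
  let D : ℕ → V → Set Ω := fun n x =>
    {ω | 1 / 32 * c₀ * ((R ^ 2 + ‖x‖ ^ 2 / 4) / 2) * (1 / 4 * (3 / 4) ^ n) / 2 ≤
      η x ω - η (p n x) ω}
  let N0 := (N 0).filter fun x => 31 / 32 * R ≤ ‖x‖
  have hcover : {ω | ∃ u ∈ U, R ≤ ‖u‖ ∧ Φ u 0 ≤ 2 * η u ω} ≤ᵐ[P]
      ((⋃ x ∈ N0, A x) ∪ ⋃ n, ⋃ x ∈ N (n + 1), D n x : Set Ω) := by
    have hsum1 : ∀ M, ∑ n ∈ Finset.range M, d * (1 / 2 : ℝ) ^ n ≤ 2 * d := fun M => by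
      rw [← Finset.mul_sum, mul_comm]
      gcongr
      rw [geom_sum_eq (by norm_num)]
      have : (0 : ℝ) < (1 / 2) ^ M := by positivity
      have e : ((1 / 2 : ℝ) ^ M - 1) / (1 / 2 - 1) = 2 - 2 * (1 / 2) ^ M := by ring
      linarith
    have hsum2 : ∀ M, ∑ n ∈ Finset.range M, 1 / 4 * (3 / 4 : ℝ) ^ n ≤ 1 := fun M => by
      rw [← Finset.mul_sum, geom_sum_eq (by norm_num)]
      have : (0 : ℝ) < (3 / 4) ^ M := by positivity
      have e : ((3 / 4 : ℝ) ^ M - 1) / (3 / 4 - 1) = 4 - 4 * (3 / 4) ^ M := by ring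
      linarith
    filter_upwards [hcont] with ω hω
    rintro ⟨u, hu, hRu, hge⟩
    have hΦu : c₀ * ‖u‖ ^ 2 ≤ Φ u 0 := by simpa using (hΦ u hu 0 h0).1
    have hu1 : 1 ≤ ‖u‖ ^ 2 := one_le_pow₀ (hR.trans hRu)
    have hΦ0 : c₀ ≤ Φ u 0 := le_trans (by nlinarith) hΦu
    have hpU : ∀ n, p n u ∈ U := fun n => hNU n (hp n u hu).1
    -- Path continuity reduces the uncountable supremum to net points, at the cost of lowering 1/2
    -- to 31/64.
    have htend : Tendsto (fun n => p n u) atTop (𝓝[U] u) := by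
      refine tendsto_nhdsWithin_iff.2 ⟨?_, Eventually.of_forall hpU⟩
      rw [tendsto_iff_dist_tendsto_zero]
      refine squeeze_zero (fun _ => dist_nonneg)
        (fun n => (dist_comm _ _).trans_le (hp n u hu).2) ?_
      simpa using (tendsto_pow_atTop_nhds_zero_of_lt_one (by norm_num : (0 : ℝ) ≤ 1 / 2)
        (by norm_num)).const_mul d
    have htη := (hω u hu).tendsto.comp htend
    obtain ⟨M, hM⟩ := (htη.eventually_const_lt
      (show 31 / 64 * Φ u 0 < η u ω by linarith)).exists
    simp only [Function.comp_apply] at hM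
    have hdM : dist u (p M u) ≤ d := (hp M u hu).2.trans
      (mul_le_of_le_one_right hd.le (pow_le_one₀ (by norm_num) (by norm_num)))
    have hclose : ∀ x, dist (p M u) x ≤ ∑ n ∈ Finset.range M, d * (1 / 2 : ℝ) ^ n →
        ‖x - u‖ ≤ 3 * d := fun x hx => by
      rw [← dist_eq_norm, dist_comm]
      linarith [dist_triangle u (p M u) x, hsum1 M]
    rcases chaining_dichotomy (N := N) (p := p) (e := fun n => d * (1 / 2 : ℝ) ^ n)
      (w := fun n => 1 / 4 * (3 / 4 : ℝ) ^ n)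
      (fun n x hx => (hp n x (hNU _ hx)).1) (fun n => (he n).le)
      (fun n x hx => (hp n x (hNU _ hx)).2) (fun x => 2 * η x ω) (1 / 32 * Φ u 0) M (p M u)
      (hp M u hu).1 with ⟨x, hx, hdist, hg⟩ | ⟨n, x, hx, hdist, hg⟩
    · have hxu := hclose x hdist
      have hxU := hNU 0 hx
      have hnorm : ‖u‖ ≤ ‖x‖ + 3 * d := by
        have := norm_sub_norm_le u x
        rw [norm_sub_rev] at this
        linarith
      refine Or.inl (Set.mem_biUnion (Finset.mem_filter.2 ⟨hx, by linarith⟩) ?_)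
      have h1 := htri u hu x hxU (1 / 32) (by norm_num)
      have h2 := (hΦ x hxU u hu).2
      have h3 : ‖x - u‖ ^ 2 ≤ (3 * d) ^ 2 := by gcongr
      have h4 : c₁ * ‖x - u‖ ^ 2 ≤ c₁ * (3 * d) ^ 2 := by gcongr
      have h5 : (0 : ℝ) < Φ u 0 := hc₀.trans_le hΦ0
      have h6 : 1 / 32 * Φ u 0 * ∑ n ∈ Finset.range M, 1 / 4 * (3 / 4 : ℝ) ^ n ≤ 1 / 32 * Φ u 0 :=
        mul_le_of_le_one_right (by positivity) (hsum2 M)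
      change 15 / 34 * Φ x 0 ≤ η x ω
      norm_num at h1
      nlinarith
    · have hxu := hclose x hdist
      have hnorm : ‖x‖ ≤ ‖u‖ + 3 * d := by
        have := norm_sub_norm_le x u
        linarith
      refine Or.inr (Set.mem_iUnion.2 ⟨n, Set.mem_biUnion hx ?_⟩)
      change 1 / 32 * c₀ * ((R ^ 2 + ‖x‖ ^ 2 / 4) / 2) * (1 / 4 * (3 / 4) ^ n) / 2 ≤
        η x ω - η (p n x) ω
      have h1 : ‖x‖ ≤ 2 * ‖u‖ := by linarith
      have h2 : ‖x‖ ^ 2 ≤ (2 * ‖u‖) ^ 2 := by gcongr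
      have h3 : R ^ 2 ≤ ‖u‖ ^ 2 := by gcongr
      have h4 : c₀ * ((R ^ 2 + ‖x‖ ^ 2 / 4) / 2) ≤ Φ u 0 := le_trans (by
        gcongr
        linarith) hΦu
      have h5 : 1 / 32 * (c₀ * ((R ^ 2 + ‖x‖ ^ 2 / 4) / 2)) * (1 / 4 * (3 / 4 : ℝ) ^ n) ≤
          1 / 32 * Φ u 0 * (1 / 4 * (3 / 4 : ℝ) ^ n) := by gcongr
      linarith
  have hA : ∀ x ∈ N0, P (A x) ≤
      ENNReal.ofReal (Real.exp (-b * R ^ 2) * Real.exp (-(b / 4) * ‖x‖ ^ 2)) := by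
    intro x hx
    obtain ⟨hx0, hxR⟩ := Finset.mem_filter.1 hx
    have hxU := hNU 0 hx0
    have hx1 : 0 < ‖x‖ := by linarith
    have hΦx : c₀ * ‖x‖ ^ 2 ≤ Φ x 0 := by simpa using (hΦ x hxU 0 h0).1
    have hΦ0 : 0 < Φ x 0 := lt_of_lt_of_le (by positivity) hΦx
    have h1 := (hsub x hxU 0 h0).measure_ge_le (ε := 15 / 34 * Φ x 0) (by positivity)
    simp only [hη0, sub_zero] at h1
    rw [← ofReal_measureReal]
    refine ENNReal.ofReal_le_ofReal (h1.trans ?_)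
    rw [← Real.exp_add, Real.exp_le_exp, Real.coe_toNNReal _ (by positivity)]
    have h2 : -(15 / 34 * Φ x 0) ^ 2 / (2 * (s2 * Φ x 0)) = -(225 / 2312 * (Φ x 0 / s2)) := by
      field_simp
      norm_num
    -- The exponent is at least (225·16/2312) b‖x‖². This covers both `b * R²`, which is at most
    -- (32/31)² b‖x‖², and the reserve (b/4)‖x‖² that makes the sum over the net converge.
    have h3 : 16 * b * ‖x‖ ^ 2 ≤ Φ x 0 / s2 := by
      rw [le_div_iff₀ hs2]
      nlinarith [sq_nonneg ‖x‖]
    have h4 : (31 / 32 * R) ^ 2 ≤ ‖x‖ ^ 2 := by gcongr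
    have h5 : b * (31 / 32 * R) ^ 2 ≤ b * ‖x‖ ^ 2 := by gcongr
    have h6 : 0 ≤ b * R ^ 2 := by positivity
    rw [h2]
    nlinarith
  have hD : ∀ n, ∀ x ∈ N (n + 1), P (D n x) ≤ ENNReal.ofReal
      (Real.exp (-b * R ^ 2) * Real.exp (-b * 2 ^ n) * Real.exp (-(b / 4) * ‖x‖ ^ 2)) := by
    intro n x hx
    have hxU := hNU _ hx
    have hpU := hNU _ (hp n x hxU).1
    have hle : (s2 * Φ x (p n x)).toNNReal ≤ (s2 * (c₁ * (d * (1 / 2) ^ n) ^ 2)).toNNReal := by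
      refine Real.toNNReal_le_toNNReal ?_
      have h2 := (hp n x hxU).2
      rw [dist_eq_norm] at h2
      have h3 := (hΦ x hxU _ hpU).2
      have h4 : c₁ * ‖x - p n x‖ ^ 2 ≤ c₁ * (d * (1 / 2) ^ n) ^ 2 := by gcongr
      exact mul_le_mul_of_nonneg_left (h3.trans h4) hs2.le
    have h1 := (HasSubgaussianMGF.mono (hsub x hxU _ hpU) hle).measure_ge_le
      (ε := 1 / 32 * c₀ * ((R ^ 2 + ‖x‖ ^ 2 / 4) / 2) * (1 / 4 * (3 / 4) ^ n) / 2) (by positivity)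
    rw [← ofReal_measureReal]
    refine ENNReal.ofReal_le_ofReal (h1.trans ?_)
    rw [← Real.exp_add, ← Real.exp_add, Real.exp_le_exp, Real.coe_toNNReal _ (by positivity)]
    exact link_exponent_le hc₀ hc₁ hs2 hb hd hd3 hR
  have hAsum : P (⋃ x ∈ N0, A x) ≤ ENNReal.ofReal (Real.exp (-b * R ^ 2) * (C * (d⁻¹) ^ q)) := by
    refine (measure_biUnion_finset_le _ _).trans ((Finset.sum_le_sum hA).trans ?_)
    rw [← ENNReal.ofReal_sum_of_nonneg fun x _ => by positivity, ← Finset.mul_sum]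
    refine ENNReal.ofReal_le_ofReal ?_
    gcongr
    refine hC d hd (by linarith) N0 fun x hx y hy hxy => ?_
    simpa using hsep 0 x (Finset.mem_filter.1 hx).1 y (Finset.mem_filter.1 hy).1 hxy
  have hDsum : P (⋃ n, ⋃ x ∈ N (n + 1), D n x) ≤ ENNReal.ofReal (Real.exp (-b * R ^ 2) * S) := by
    refine (measure_iUnion_le _).trans ?_
    rw [hS, ← tsum_mul_left, ENNReal.ofReal_tsum_of_nonneg (fun n => by positivity)
      (hsummable.mul_left _)]
    refine ENNReal.tsum_le_tsum fun n => ?_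
    refine (measure_biUnion_finset_le _ _).trans ((Finset.sum_le_sum (hD n)).trans ?_)
    rw [← ENNReal.ofReal_sum_of_nonneg fun x _ => by positivity, ← Finset.mul_sum]
    refine ENNReal.ofReal_le_ofReal ?_
    have := hC _ (he (n + 1)) (mul_le_one₀ (by linarith) (by positivity)
      (pow_le_one₀ (by norm_num) (by norm_num))) (N (n + 1)) (hsep (n + 1))
    calc _ ≤ Real.exp (-b * R ^ 2) * Real.exp (-b * 2 ^ n) *
          (C * ((d * (1 / 2) ^ (n + 1))⁻¹) ^ q) := by gcongr
      _ = _ := by ring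
  have htotal : P {ω | ∃ u ∈ U, R ≤ ‖u‖ ∧ Φ u 0 ≤ 2 * η u ω} ≤
      ENNReal.ofReal ((C * (d⁻¹) ^ q + S + 1) * Real.exp (-b * R ^ 2)) := by
    refine (measure_mono_ae hcover).trans ((measure_union_le _ _).trans
      ((add_le_add hAsum hDsum).trans ?_))
    rw [← ENNReal.ofReal_add (by positivity) (by positivity)]
    refine ENNReal.ofReal_le_ofReal ?_
    nlinarith [Real.exp_pos (-b * R ^ 2)]
  exact ENNReal.toReal_le_of_le_ofReal (by positivity) htotal

/-! ### The regression model in local coordinates and the basic inequality. -/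

theorem sq_intervalIntegral_mul_le {f g : ℝ → ℝ} {T : ℝ} (hT : 0 ≤ T)
    (hf : ContinuousOn f (Set.uIcc 0 T)) (hg : ContinuousOn g (Set.uIcc 0 T)) :
    (∫ t in (0 : ℝ)..T, f t * g t) ^ 2 ≤
      (∫ t in (0 : ℝ)..T, f t ^ 2) * ∫ t in (0 : ℝ)..T, g t ^ 2 := by
  have h : ∀ x : ℝ, 0 ≤ (∫ t in (0 : ℝ)..T, f t ^ 2) * (x * x) +
      (2 * ∫ t in (0 : ℝ)..T, f t * g t) * x + ∫ t in (0 : ℝ)..T, g t ^ 2 := by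
    intro x
    have h1 : IntervalIntegrable (fun t => (x * x) * f t ^ 2) volume 0 T :=
      (continuousOn_const.mul (hf.pow 2)).intervalIntegrable
    have h2 : IntervalIntegrable (fun t => (2 * x) * (f t * g t)) volume 0 T :=
      (continuousOn_const.mul (hf.mul hg)).intervalIntegrable
    have h3 : IntervalIntegrable (fun t => g t ^ 2) volume 0 T := (hg.pow 2).intervalIntegrable
    have h4 : 0 ≤ ∫ t in (0 : ℝ)..T, (x * f t + g t) ^ 2 :=
      intervalIntegral.integral_nonneg hT fun _ _ => sq_nonneg _
    have h5 : ∀ t, (x * f t + g t) ^ 2 = (x * x) * f t ^ 2 + (2 * x) * (f t * g t) + g t ^ 2 :=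
      fun t => by ring
    simp only [h5] at h4
    rw [intervalIntegral.integral_add (by exact h1.add h2) h3, intervalIntegral.integral_add h1 h2,
      intervalIntegral.integral_const_mul, intervalIntegral.integral_const_mul] at h4
    linarith
  have := discrim_le_zero h
  rw [discrim] at this
  nlinarith

theorem continuous_diagMul {q : ℕ} (s : Fin q → ℝ) : Continuous (diagMul s) := by
  unfold diagMul
  fun_prop

theorem diagMul_zero {q : ℕ} (s : Fin q → ℝ) : diagMul s 0 = 0 := by
  ext i; simp [diagMul]

theorem diagMul_inv_diagMul {q : ℕ} {s : Fin q → ℝ} (hs : ∀ i, s i ≠ 0)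
    (x : EuclideanSpace ℝ (Fin q)) : diagMul (fun i => (s i)⁻¹) (diagMul s x) = x := by
  ext i; simp [diagMul, hs i]

/-- Makes the local coordinates invertible. Since `0⁻¹ = 0`, a vanishing scale would contradict the
positive lower bound `cl`. -/
theorem IsNormalization.ne_zero {q : ℕ} {Θ : Set (EuclideanSpace ℝ (Fin q))}
    {a : ℝ → EuclideanSpace ℝ (Fin q) → ℝ} {s : ℝ → Fin q → ℝ} {T₀ T : ℝ}
    (h : IsNormalization Θ a s T₀) {θ : EuclideanSpace ℝ (Fin q)} (hθ : θ ∈ Θ) (hT : T₀ < T)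
    (i : Fin q) : s T i ≠ 0 := by
  obtain ⟨cl, cu, hc⟩ := h
  intro h0
  have := ((hc i).2.2 θ hθ T hT).1
  rw [h0, inv_zero, zero_mul] at this
  exact lt_asymm this (hc i).1

section Model

variable {q : ℕ} {Θ : Set (EuclideanSpace ℝ (Fin q))} {a : ℝ → EuclideanSpace ℝ (Fin q) → ℝ}
  {θ : EuclideanSpace ℝ (Fin q)} {σ : Fin q → ℝ}

theorem add_diagMul_inv_mem_of_mem_localSet (hσ : ∀ i, σ i ≠ 0) {u : EuclideanSpace ℝ (Fin q)}
    (hu : u ∈ localSet Θ σ θ) : θ + diagMul (fun i => (σ i)⁻¹) u ∈ closure Θ := by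
  obtain ⟨τ, hτ, rfl⟩ := hu
  simpa [diagMul_inv_diagMul hσ] using hτ

theorem zero_mem_localSet (hθ : θ ∈ Θ) : (0 : EuclideanSpace ℝ (Fin q)) ∈ localSet Θ σ θ :=
  ⟨θ, subset_closure hθ, by simp [diagMul_zero]⟩

theorem totallyBounded_localSet (hΘ : Bornology.IsBounded Θ) :
    TotallyBounded (localSet Θ σ θ) := by
  have hc : IsCompact (closure Θ) := hΘ.isCompact_closure
  exact (hc.image ((continuous_diagMul σ).comp (continuous_id.sub continuous_const))).totallyBounded

theorem IsRegressionFunction.continuousOn_regressionIncrement (ha : IsRegressionFunction Θ a)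
    (hθ : θ ∈ Θ) (hσ : ∀ i, σ i ≠ 0) {u : EuclideanSpace ℝ (Fin q)} (hu : u ∈ localSet Θ σ θ)
    {T : ℝ} (hT : 0 ≤ T) :
    ContinuousOn (fun t => regressionIncrement a σ θ t u) (Set.uIcc 0 T) := by
  have key : ∀ τ ∈ closure Θ, ContinuousOn (fun t => a t τ) (Set.uIcc 0 T) := fun τ hτ => by
    refine ha.continuousOn.comp (f := fun t : ℝ => (t, τ)) (by fun_prop) fun t ht => ?_
    rw [Set.uIcc_of_le hT] at ht
    exact ⟨ht.1, hτ⟩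
  exact (key _ (add_diagMul_inv_mem_of_mem_localSet hσ hu)).sub (key _ (subset_closure hθ))

theorem regressionIncrement_zero (t : ℝ) : regressionIncrement a σ θ t 0 = 0 := by
  simp [regressionIncrement, diagMul_zero]

theorem IsRegressionFunction.phiDist_le_add (ha : IsRegressionFunction Θ a) (hθ : θ ∈ Θ)
    (hσ : ∀ i, σ i ≠ 0) {T : ℝ} (hT : 0 ≤ T) {u v : EuclideanSpace ℝ (Fin q)}
    (hu : u ∈ localSet Θ σ θ) (hv : v ∈ localSet Θ σ θ) {r : ℝ} (hr : 0 < r) :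
    phiDist a σ θ T v 0 ≤ (1 + r) * phiDist a σ θ T u 0 + (1 + r⁻¹) * phiDist a σ θ T v u := by
  have hcu := ha.continuousOn_regressionIncrement hθ hσ hu hT
  have hcv := ha.continuousOn_regressionIncrement hθ hσ hv hT
  simp only [phiDist, regressionIncrement_zero, sub_zero]
  have h1 : IntervalIntegrable (fun t => (1 + r) * regressionIncrement a σ θ t u ^ 2)
      volume 0 T := (continuousOn_const.mul (hcu.pow 2)).intervalIntegrable
  have h2 : IntervalIntegrable (fun t => (1 + r⁻¹) *
      (regressionIncrement a σ θ t v - regressionIncrement a σ θ t u) ^ 2) volume 0 T :=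
    (continuousOn_const.mul ((hcv.sub hcu).pow 2)).intervalIntegrable
  rw [← intervalIntegral.integral_const_mul, ← intervalIntegral.integral_const_mul,
    ← intervalIntegral.integral_add h1 h2]
  refine intervalIntegral.integral_mono_on hT (hcv.pow 2).intervalIntegrable (h1.add h2)
    fun t _ => ?_
  set x := regressionIncrement a σ θ t u
  set y := regressionIncrement a σ θ t v
  -- Young's inequality with its defect written as a square.
  have h3 : (1 + r) * x ^ 2 + (1 + r⁻¹) * (y - x) ^ 2 - y ^ 2 = r⁻¹ * (r * x - (y - x)) ^ 2 := by
    field_simp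
    ring
  have h4 : 0 ≤ r⁻¹ * (r * x - (y - x)) ^ 2 := by positivity
  linarith

/-- The basic inequality for the least squares estimator: in local coordinates its squared
distance to the true parameter is at most twice the noise contribution. -/
theorem IsRegressionFunction.phiDist_le_of_isMinOn (ha : IsRegressionFunction Θ a) (hθ : θ ∈ Θ)
    (hσ : ∀ i, σ i ≠ 0) {T : ℝ} (hT : 0 ≤ T) {Ω : Type*} {X ε : ℝ → Ω → ℝ} {ω : Ω}
    (hX : ∀ t, 0 ≤ t → X t ω = a t θ + ε t ω) (hε : Continuous fun t => ε t ω)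
    {τ : EuclideanSpace ℝ (Fin q)} (hτ : τ ∈ closure Θ)
    (hmin : IsMinOn (leastSquaresCriterion a X T ω) (closure Θ) τ) :
    phiDist a σ θ T (diagMul σ (τ - θ)) 0 ≤
      2 * ∫ t in (0 : ℝ)..T, regressionIncrement a σ θ t (diagMul σ (τ - θ)) * ε t ω := by
  set u := diagMul σ (τ - θ) with hu
  have hc := ha.continuousOn_regressionIncrement hθ hσ (u := u) ⟨τ, hτ, rfl⟩ hT
  have hΔ : ∀ t, regressionIncrement a σ θ t u = a t τ - a t θ := fun t => by
    simp [regressionIncrement, hu, diagMul_inv_diagMul hσ]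
  have h := hmin (subset_closure hθ)
  simp only [Set.mem_ofPred_eq, leastSquaresCriterion] at h
  have e1 : ∫ t in (0 : ℝ)..T, (X t ω - a t θ) ^ 2 = ∫ t in (0 : ℝ)..T, ε t ω ^ 2 := by
    refine intervalIntegral.integral_congr fun t ht => ?_
    rw [Set.uIcc_of_le hT] at ht
    simp only [hX t ht.1]
    ring
  have h1 : IntervalIntegrable (fun t => ε t ω ^ 2) volume 0 T :=
    (hε.pow 2).intervalIntegrable _ _
  have h2 : IntervalIntegrable (fun t => 2 * (regressionIncrement a σ θ t u * ε t ω)) volume 0 T :=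
    (continuousOn_const.mul (hc.mul hε.continuousOn)).intervalIntegrable
  have h3 : IntervalIntegrable (fun t => regressionIncrement a σ θ t u ^ 2) volume 0 T :=
    (hc.pow 2).intervalIntegrable
  have e2 : ∫ t in (0 : ℝ)..T, (X t ω - a t τ) ^ 2 = (∫ t in (0 : ℝ)..T, ε t ω ^ 2) -
      2 * (∫ t in (0 : ℝ)..T, regressionIncrement a σ θ t u * ε t ω) +
        ∫ t in (0 : ℝ)..T, regressionIncrement a σ θ t u ^ 2 := by
    rw [← intervalIntegral.integral_const_mul, ← intervalIntegral.integral_sub h1 h2,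
      ← intervalIntegral.integral_add (by exact h1.sub h2) h3]
    refine intervalIntegral.integral_congr fun t ht => ?_
    rw [Set.uIcc_of_le hT] at ht
    simp only [hX t ht.1, hΔ]
    ring
  simp only [phiDist, regressionIncrement_zero, sub_zero]
  rw [e1, e2] at h
  linarith

end Model

/-! ### Assembling the exponential bound. -/

/-- Exponential bound for the normalized least squares estimator, with any rate `b ≤ c₀ / (16 s2)`
where `s2` bounds `2π f₀`. -/
theorem exists_leastSquares_tail_bound {Ω : Type*} [MeasurableSpace Ω] (P : Measure Ω)
    [IsProbabilityMeasure P]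
    {q : ℕ} {Θ : Set (EuclideanSpace ℝ (Fin q))} {θ : EuclideanSpace ℝ (Fin q)} (hθ : θ ∈ Θ)
    {a : ℝ → EuclideanSpace ℝ (Fin q) → ℝ} (ha : IsRegressionFunction Θ a)
    {ψ : ℝ → ℝ} {ξ ε X : ℝ → Ω → ℝ} (hX : ∀ t, 0 ≤ t → ∀ ω, X t ω = a t θ + ε t ω)
    (hε : IsCentredContinuousNoise P ε) (hψ : IsFilteredWhiteNoise P ψ ξ ε)
    (hsup : spectralSup ψ hψ.sq_integrable < ⊤)
    {s : ℝ → Fin q → ℝ} {T₀ : ℝ} (hT₀ : 0 ≤ T₀) (hs : IsNormalization Θ a s T₀)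
    {c₀ c₁ : ℝ} (hc₀ : 0 < c₀) (hc₁ : 0 < c₁) (hsep : QuadraticSeparation Θ a s θ T₀ c₀ c₁)
    {s2 b : ℝ} (hs2 : 0 < s2) (hle : 2 * Real.pi * (spectralSup ψ hψ.sq_integrable).toReal ≤ s2)
    (hb : 0 < b) (hbc : 16 * b * s2 ≤ c₀) :
    ∃ B : ℝ, 0 < B ∧ ∀ T > T₀, ∀ θT : Ω → EuclideanSpace ℝ (Fin q),
      IsLeastSquaresEstimator P Θ a X T θT → ∀ R : ℝ, 1 ≤ R →
        P.real {ω | R ≤ ‖diagMul (s T) (θT ω - θ)‖} ≤ B * Real.exp (-b * R ^ 2) := by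
  obtain ⟨B, hB, hmain⟩ := exists_tail_bound P (EuclideanSpace ℝ (Fin q)) hc₀ hc₁ hs2 hb hbc
  refine ⟨B, hB, fun T hT θT hθT R hR => ?_⟩
  have hT0 : 0 < T := hT₀.trans_lt hT
  have hσ : ∀ i, s T i ≠ 0 := hs.ne_zero hθ hT
  have hcont : ∀ u ∈ localSet Θ (s T) θ,
      ContinuousOn (fun t => regressionIncrement a (s T) θ t u) (Set.uIcc 0 T) := fun u hu =>
    ha.continuousOn_regressionIncrement hθ hσ hu hT0.le
  have hdiff : ∀ u ∈ localSet Θ (s T) θ, ∀ v ∈ localSet Θ (s T) θ, ∀ ω,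
      Continuous (fun t => ε t ω) →
      ∫ t in (0 : ℝ)..T, (regressionIncrement a (s T) θ t u - regressionIncrement a (s T) θ t v) *
        ε t ω = (∫ t in (0 : ℝ)..T, regressionIncrement a (s T) θ t u * ε t ω) -
          ∫ t in (0 : ℝ)..T, regressionIncrement a (s T) θ t v * ε t ω := by
    intro u hu v hv ω hω
    rw [← intervalIntegral.integral_sub
      (by exact ((hcont u hu).mul hω.continuousOn).intervalIntegrable)
      (by exact ((hcont v hv).mul hω.continuousOn).intervalIntegrable)]
    exact intervalIntegral.integral_congr fun t _ => by ring
  have hbound := hmain (localSet Θ (s T) θ) (phiDist a (s T) θ T)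
    (fun u ω => ∫ t in (0 : ℝ)..T, regressionIncrement a (s T) θ t u * ε t ω)
    (totallyBounded_localSet ha.isBounded) (zero_mem_localSet hθ) (hsep T hT)
    (fun u hu v hv r hr => ha.phiDist_le_add hθ hσ hT0.le hu hv hr) ?_ ?_ ?_ R hR
  · refine le_trans (ENNReal.toReal_mono (measure_ne_top _ _) (measure_mono_ae ?_)) hbound
    filter_upwards [hθT.2, hε.ae_continuous] with ω hω hεω hRω
    exact ⟨diagMul (s T) (θT ω - θ), ⟨θT ω, hω.1, rfl⟩, hRω,
      ha.phiDist_le_of_isMinOn hθ hσ hT0.le (fun t ht => hX t ht ω) hεω hω.1 hω.2⟩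
  · intro u hu v hv
    have hc := (hcont u hu).sub (hcont v hv)
    rw [Set.uIcc_of_le hT0.le] at hc
    refine (HasSubgaussianMGF.mono (hψ.hasSubgaussianMGF_integral hε hsup hT0 hc) ?_).congr ?_
    · refine Real.toNNReal_le_toNNReal (mul_le_mul_of_nonneg_right hle ?_)
      exact intervalIntegral.integral_nonneg hT0.le fun _ _ => sq_nonneg _
    · filter_upwards [hε.ae_continuous] with ω hω
      exact hdiff u hu v hv ω hω
  · intro ω
    simp [regressionIncrement_zero]
  · filter_upwards [hε.ae_continuous] with ω hω
    set I := ∫ t in (0 : ℝ)..T, ε t ω ^ 2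
    have hI : 0 ≤ I := intervalIntegral.integral_nonneg hT0.le fun _ _ => sq_nonneg _
    -- By Cauchy–Schwarz and the upper bound on Φ, the field is Lipschitz along every continuous
    -- path, with the random constant (c₁ ∫₀ᵀ ε²)^(1/2).
    refine (LipschitzOnWith.of_dist_le_mul (K := ⟨Real.sqrt (c₁ * I), Real.sqrt_nonneg _⟩)
      fun u hu v hv => ?_).continuousOn
    rw [Real.dist_eq, ← hdiff u hu v hv ω hω, dist_eq_norm]
    change _ ≤ Real.sqrt (c₁ * I) * ‖u - v‖
    refine abs_le_of_sq_le_sq ?_ (by positivity)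
    rw [mul_pow, Real.sq_sqrt (by positivity)]
    refine (sq_intervalIntegral_mul_le hT0.le ((hcont u hu).sub (hcont v hv))
      hω.continuousOn).trans ?_
    have := mul_le_mul_of_nonneg_right (hsep T hT u hu v hv).2 hI
    exact this.trans (le_of_eq (by ring))

theorem corollary4 {Ω : Type*} [MeasurableSpace Ω] (P : Measure Ω) [IsProbabilityMeasure P]
    {q : ℕ} (Θ : Set (EuclideanSpace ℝ (Fin q))) (θ : EuclideanSpace ℝ (Fin q)) (hθ : θ ∈ Θ)
    (a : ℝ → EuclideanSpace ℝ (Fin q) → ℝ) (ha : IsRegressionFunction Θ a)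
    (ψ : ℝ → ℝ) (ξ ε X : ℝ → Ω → ℝ)
    -- the regression model
    (hX : ∀ t, 0 ≤ t → ∀ ω, X t ω = a t θ + ε t ω)
    -- the noise and its spectral density
    (hN1 : IsCentredContinuousNoise P ε)
    (hN4i : IsFilteredWhiteNoise P ψ ξ ε)
    (hN4ii : spectralSup ψ hN4i.sq_integrable < ⊤)
    -- the normalization and the separation condition
    (s : ℝ → Fin q → ℝ) (T₀ : ℝ) (hT₀ : 0 ≤ T₀) (hs : IsNormalization Θ a s T₀)
    (c₀ c₁ : ℝ) (hc₀ : 0 < c₀) (hc₁ : c₀ < c₁)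
    (hR3 : QuadraticSeparation Θ a s θ T₀ c₀ c₁) :
    ∃ R₀ : ℝ, 0 < R₀ ∧ ∀ β : ℝ, 0 < β → ∃ B b : ℝ, 0 < B ∧ 0 < b ∧
      c₀ / (16 * Real.pi * (spectralSup ψ hN4i.sq_integrable).toReal * (1 + (q : ℝ))) - β ≤ b ∧
      ∀ T > T₀, ∀ θT : Ω → EuclideanSpace ℝ (Fin q), IsLeastSquaresEstimator P Θ a X T θT →
        ∀ R > R₀, P.real {ω | R ≤ ‖diagMul (s T) (θT ω - θ)‖} ≤ B * Real.exp (-b * R ^ 2) := by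
  -- Chaining starts at a scale `d ≤ 1/96` independent of `R`, so it needs `R` bounded below; 1 is
  -- the bound used.
  refine ⟨1, one_pos, fun β hβ => ?_⟩
  set f := (spectralSup ψ hN4i.sq_integrable).toReal with hf
  have hf0 : 0 ≤ f := ENNReal.toReal_nonneg
  have hpi := Real.pi_pos
  rcases Nat.eq_zero_or_pos q with rfl | hq
  -- For `q = 0` the required rate may exceed c₀ / (32π f₀), but the parameter space is a single
  -- point and the event is empty for `R > 1`.
  · refine ⟨1, c₀ / (16 * Real.pi * f * (1 + ((0 : ℕ) : ℝ))) + 1, one_pos, by positivity,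
      by linarith, fun T _ θT _ R hR => ?_⟩
    have hempty : {ω | R ≤ ‖diagMul (s T) (θT ω - θ)‖} = ∅ := by
      ext ω
      have h0 : diagMul (s T) (θT ω - θ) = 0 := Subsingleton.elim _ _
      simp only [Set.mem_ofPred_eq, h0, norm_zero, Set.mem_empty_iff_false, iff_false, not_le]
      linarith
    rw [hempty, measureReal_empty]
    positivity
  have hq1 : (1 : ℝ) ≤ q := by exact_mod_cast hq
  obtain ⟨s2, b, hs2, hle, hb, hbc, hbβ⟩ : ∃ s2 b : ℝ, 0 < s2 ∧ 2 * Real.pi * f ≤ s2 ∧ 0 < b ∧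
      16 * b * s2 ≤ c₀ ∧ c₀ / (16 * Real.pi * f * (1 + (q : ℝ))) - β ≤ b := by
    rcases hf0.eq_or_lt with h0 | hpos
    -- For `f = 0` the quotient is 0 by convention, so any positive rate will do; `s2 = 1` keeps the
    -- proxy bound positive.
    · refine ⟨1, c₀ / 16, one_pos, by simp [← h0], by positivity, by linarith, ?_⟩
      rw [← h0, mul_zero, zero_mul, div_zero]
      linarith
    · refine ⟨2 * Real.pi * f, c₀ / (16 * Real.pi * f * (1 + (q : ℝ))), by positivity, le_rfl,
        by positivity, ?_, by linarith⟩
      -- The rate condition `16 * b * s2 ≤ c₀` becomes 2 / (1 + q) ≤ 1, that is `q ≥ 1`.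
      have : 16 * (c₀ / (16 * Real.pi * f * (1 + (q : ℝ)))) * (2 * Real.pi * f) =
          c₀ * (2 / (1 + q)) := by
        field_simp
      rw [this]
      refine mul_le_of_le_one_right hc₀.le ?_
      rw [div_le_one (by positivity)]
      linarith
  obtain ⟨B, hB, h⟩ := exists_leastSquares_tail_bound P hθ ha hX hN1 hN4i hN4ii hT₀ hs hc₀
    (hc₀.trans hc₁) hR3 hs2 hle hb hbc
  exact ⟨B, b, hB, hb, hbβ, fun T hT θT hθT R hR => h T hT θT hθT R hR.le⟩
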